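/- **Setting.** Let $A\in\mathbb R_{\ge 0}^{m\times n}$ be normalized so that $\max_i A_{ij}=1$ for every column $j$, let $N$ be the number of nonzero entries of $A$, and let $0<\epsilon\le n/2$. The 1-fair packing problem is to maximize $f(x)=\sum_{j=1}^n\log x_j$ (with $\log 0=-\infty$) over $\{x\in\mathbb R^n_{\ge0}: Ax\le \mathbf 1\}$; let $x^*$ be its solution. Put $$\beta=\frac{\epsilon}{6n\log(2mn^2/\epsilon)},\qquad \omega=\log\frac{mn}{1-\epsilon/n},\qquad B=[-\omega,0]^n,$$ $$f_r(x)=-\sum_j x_j+\frac{\beta}{1+\beta}\sum_{i=1}^m (A\exp(x))_i^{(1+\beta)/\beta}\quad(\exp \text{ entrywise}),$$ let $x_r^*$ be the minimizer of $f_r$ over $B$, and let $g(x)=(\min\{1,\partial_j f_r(x)\})_{j}$ be the truncated gradient. **Algorithm.** Let $$L=\max\Big\{\frac{4\omega(1+\beta)}{\beta},\ \frac{16n\log(2mn)}{3\epsilon}+\frac13\Big\},\quad \tau=\frac1{3L},\quad \eta_0=\frac1{3L},\quad T=\Big\lceil \frac{\log(4n\log(2mn)/\epsilon)}{\log(1/(1-\tau))}\Big\rceil,$$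 $x^{(0)}=y^{(0)}=z^{(0)}=-\omega\mathbf 1$, and for $k=1,\dots,T$ let $\eta_k=\eta_{k-1}/(1-\tau)$, $$x^{(k)}=\tau z^{(k-1)}+(1-\tau)y^{(k-1)},\qquad z^{(k)}=\operatorname*{argmin}_{z\in B}\Big\{\tfrac1{2\omega}\|z-z^{(k-1)}\|_2^2+\langle\eta_k g(x^{(k)}),z\rangle\Big\},$$ $$y^{(k)}=x^{(k)}+\tfrac1{\eta_kL}\big(z^{(k)}-z^{(k-1)}\big).$$ The output is $\bar x=\exp(y^{(T)})/(1+\epsilon/n)$. **Distributed model.** There are $n$ agents, which all run the same finite code (independent of $A,m,n,\epsilon$) on a fixed number of private real registers, with unit-cost operations $+,-,\times,/,\min,\max$, power, $\exp$, $\log$. Initially each agent knows only $m,n,\epsilon$. In each round agent $j$ plays a number $p_j$; then for each $i$ with $A_{ij}\ne0$, one after the other, it receives the entry $A_{ij}$ and the slack $(Ap)_i-1$, and updates its registers by a fixed code; finally it updates its registers by a fixed code and performs a halting test. The cost of a round is the number of operations of all agents together with those for computing the slacks (two for each nonzero entry of $A$). **Theorem.** There are absolute constants $C>0$ and $p\in\mathbb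 N$ and one distributed protocol such that for all $m,n,A,\epsilon$ as above: 1. $T\le C\,\frac n\epsilon\,\log^p(2+m+n+1/\epsilon)$, that is, $T=\tilde O(n/\epsilon)$, with no dependence on the width $\rho=\max A_{ij}/\min_{A_{ij}\ne0}A_{ij}$. 2. The protocol carries out the algorithm: after $k\le T$ rounds, agent $j$ holds $x^{(k)}_j,y^{(k)}_j,z^{(k)}_j$ in its registers; its halting test succeeds after $k$ rounds if and only if $k\ge T$; and after $T$ rounds it returns $\bar x_j$. Every round costs at most $C N$ operations. 3. $f_r$ has a minimizer over $B$ and the 1-fair packing problem has a solution; moreover $y^{(T)}\in B$ and $f_r(y^{(T)})-f_r(x_r^*)\le\epsilon$. 4. $\bar x\ge0$, $A\bar x\le\mathbf 1$, and $f(x^*)-f(\bar x)\le5\epsilon$. -/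

import Mathlib

open scoped Matrix

noncomputable section

namespace FairPacking

/-! ### The 1-fair packing problem and its regularized reparametrization -/

/-- `A` has nonnegative entries and the maximum entry of each of its columns is `1`. -/
def Normalized {m n : ℕ} (A : Matrix (Fin m) (Fin n) ℝ) : Prop :=
  (∀ i j, 0 ≤ A i j) ∧ ∀ j, IsGreatest (Set.range fun i => A i j) 1

/-- The feasible set `{x ≥ 0 : A x ≤ 1}`. -/
def feasible {m n : ℕ} (A : Matrix (Fin m) (Fin n) ℝ) : Set (Fin n → ℝ) :=
  {x | (∀ j, 0 ≤ x j) ∧ ∀ i, (A *ᵥ x) i ≤ 1}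

/-- The objective `f x = ∑ j, log (x j)` on the nonnegative orthant, where `log 0 = -∞`. -/
def fairObjective {n : ℕ} (x : Fin n → ℝ) : EReal :=
  open Classical in
  if ∀ j, 0 < x j then ((∑ j, Real.log (x j) : ℝ) : EReal) else ⊥

/-- `x` solves the 1-fair packing problem. -/
def IsFairSolution {m n : ℕ} (A : Matrix (Fin m) (Fin n) ℝ) (x : Fin n → ℝ) : Prop :=
  x ∈ feasible A ∧ IsMaxOn fairObjective (feasible A) x

/-- Entrywise exponential. -/
def expVec {n : ℕ} (x : Fin n → ℝ) : Fin n → ℝ := fun j => Real.exp (x j)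

/-- `β = ε / (6 n log (2 m n² / ε))`. -/
def beta (m n : ℕ) (ε : ℝ) : ℝ := ε / (6 * n * Real.log (2 * m * n ^ 2 / ε))

/-- `ω = log (m n / (1 - ε / n))`. -/
def omega (m n : ℕ) (ε : ℝ) : ℝ := Real.log (m * n / (1 - ε / n))

/-- The box `B = [-ω, 0]ⁿ`. -/
def box (m n : ℕ) (ε : ℝ) : Set (Fin n → ℝ) :=
  Set.Icc (fun _ => -omega m n ε) (fun _ => 0)

/-- The regularized objective
`f_r x = -⟨1, x⟩ + β / (1 + β) * ∑ i, (A exp x)_i ^ ((1 + β) / β)`. -/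
def regObjective {m n : ℕ} (A : Matrix (Fin m) (Fin n) ℝ) (ε : ℝ) (x : Fin n → ℝ) : ℝ :=
  -∑ j, x j + beta m n ε / (1 + beta m n ε) *
    ∑ i, (A *ᵥ expVec x) i ^ ((1 + beta m n ε) / beta m n ε)

/-- `x` minimizes `f_r` over the box. -/
def IsRegMinimizer {m n : ℕ} (A : Matrix (Fin m) (Fin n) ℝ) (ε : ℝ) (x : Fin n → ℝ) : Prop :=
  x ∈ box m n ε ∧ IsMinOn (regObjective A ε) (box m n ε) x

/-- The `j`-th partial derivative of `f_r`. -/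
def gradReg {m n : ℕ} (A : Matrix (Fin m) (Fin n) ℝ) (ε : ℝ) (x : Fin n → ℝ) (j : Fin n) : ℝ :=
  deriv (fun t => regObjective A ε (Function.update x j t)) (x j)

/-- The truncated gradient. -/
def truncGrad {m n : ℕ} (A : Matrix (Fin m) (Fin n) ℝ) (ε : ℝ) (x : Fin n → ℝ) (j : Fin n) : ℝ :=
  min 1 (gradReg A ε x j)

/-! ### The accelerated method -/

/-- The parameter `L`. -/
def bigL (m n : ℕ) (ε : ℝ) : ℝ :=
  max (4 * omega m n ε * (1 + beta m n ε) / beta m n ε)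
    (16 * n * Real.log (2 * m * n) / (3 * ε) + 1 / 3)

/-- The coupling parameter `τ = 1 / (3 L)`. -/
def tau (m n : ℕ) (ε : ℝ) : ℝ := 1 / (3 * bigL m n ε)

/-- The step sizes `η₀ = 1 / (3 L)`, `η_{k+1} = η_k / (1 - τ)`. -/
def eta (m n : ℕ) (ε : ℝ) : ℕ → ℝ
  | 0 => 1 / (3 * bigL m n ε)
  | k + 1 => 1 / (1 - tau m n ε) * eta m n ε k

/-- The number `T` of iterations. -/
def iterations (m n : ℕ) (ε : ℝ) : ℕ :=
  ⌈Real.log (4 * n * Real.log (2 * m * n) / ε) / Real.log (1 / (1 - tau m n ε))⌉₊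

/-- `x`, `y`, `z` are the iterates of the algorithm: starting from `-ω 1`, each of its `T`
iterations couples `y` and `z`, makes a mirror descent step with the truncated gradient over the
box, and makes a gradient descent step. -/
structure IsRun {m n : ℕ} (A : Matrix (Fin m) (Fin n) ℝ) (ε : ℝ)
    (x y z : ℕ → Fin n → ℝ) : Prop where
  x_zero : x 0 = fun _ => -omega m n ε
  y_zero : y 0 = fun _ => -omega m n ε
  z_zero : z 0 = fun _ => -omega m n ε
  coupling : ∀ k < iterations m n ε,
    x (k + 1) = tau m n ε • z k + (1 - tau m n ε) • y k
  mirror_mem : ∀ k < iterations m n ε, z (k + 1) ∈ box m n ε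
  mirror_min : ∀ k < iterations m n ε,
    IsMinOn (fun w : Fin n → ℝ => 1 / (2 * omega m n ε) * ∑ j, (w j - z k j) ^ 2 +
      ∑ j, eta m n ε (k + 1) * truncGrad A ε (x (k + 1)) j * w j) (box m n ε) (z (k + 1))
  descent : ∀ k < iterations m n ε,
    y (k + 1) = x (k + 1) + (1 / (eta m n ε (k + 1) * bigL m n ε)) • (z (k + 1) - z k)

/-- The returned point `exp y / (1 + ε / n)`. -/
def returned {n : ℕ} (ε : ℝ) (y : Fin n → ℝ) : Fin n → ℝ :=
  fun j => Real.exp (y j) / (1 + ε / n)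

/-! ### Sparsity, and the distributed model with operation counts -/

/-- The number `N` of nonzero entries of `A`. -/
def nonzeros {m n : ℕ} (A : Matrix (Fin m) (Fin n) ℝ) : ℕ :=
  (Finset.univ.filter fun p : Fin m × Fin n => A p.1 p.2 ≠ 0).card

/-- The number of nonzero entries in row `i`. -/
def rowNonzeros {m n : ℕ} (A : Matrix (Fin m) (Fin n) ℝ) (i : Fin m) : ℕ :=
  (Finset.univ.filter fun j => A i j ≠ 0).card

/-- The constraints in which agent `j` participates. -/
def incident {m n : ℕ} (A : Matrix (Fin m) (Fin n) ℝ) (j : Fin n) : List (Fin m) :=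
  (List.finRange m).filter fun i => A i j ≠ 0

/-- Real-arithmetic expressions with variables in `V`. -/
inductive LocalExpr (V : Type) : Type
  | var (v : V)
  | const (c : ℕ)
  | add (a b : LocalExpr V)
  | sub (a b : LocalExpr V)
  | mul (a b : LocalExpr V)
  | div (a b : LocalExpr V)
  | min (a b : LocalExpr V)
  | max (a b : LocalExpr V)
  | pow (a b : LocalExpr V)
  | exp (a : LocalExpr V)
  | log (a : LocalExpr V)

/-- The value of an expression. -/
def LocalExpr.eval {V : Type} (r : V → ℝ) : LocalExpr V → ℝ
  | .var v => r v
  | .const c => c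
  | .add a b => a.eval r + b.eval r
  | .sub a b => a.eval r - b.eval r
  | .mul a b => a.eval r * b.eval r
  | .div a b => a.eval r / b.eval r
  | .min a b => Min.min (a.eval r) (b.eval r)
  | .max a b => Max.max (a.eval r) (b.eval r)
  | .pow a b => a.eval r ^ b.eval r
  | .exp a => Real.exp (a.eval r)
  | .log a => Real.log (a.eval r)

/-- The cost of an expression: one unit for every operation and for every operand that is read. -/
def LocalExpr.cost {V : Type} : LocalExpr V → ℕ
  | .var _ => 1
  | .const _ => 1
  | .add a b | .sub a b | .mul a b | .div a b | .min a b | .max a b | .pow a b =>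
      a.cost + b.cost + 1
  | .exp a | .log a => a.cost + 1

/-- A distributed protocol. All agents execute the same finite code, which does not depend on the
instance, on `numReg` private real registers.
* `start` sets the registers from the global parameters `m`, `n`, `ε` (variables `0`, `1`, `2`).
* In every round each agent plays the value `play` as its primal variable. Then, for each
  constraint `i` in which it participates, one after the other, it receives the slack
  `(A p) i - 1` of the played vector `p`, and updates its registers by `absorb`, which reads the
  registers, the entry `A i j` (variable `inr 0`) and the slack (variable `inr 1`). Finally it
  updates its registers by `finish`.
* An agent halts when the value of `halt` is at most `0`, and then returns the value `result`.
* `xReg`, `yReg`, `zReg` are registers that hold the current iterates. -/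
structure Protocol where
  numReg : ℕ
  start : Fin numReg → LocalExpr (Fin 3)
  play : LocalExpr (Fin numReg)
  absorb : Fin numReg → LocalExpr (Fin numReg ⊕ Fin 2)
  finish : Fin numReg → LocalExpr (Fin numReg)
  halt : LocalExpr (Fin numReg)
  result : LocalExpr (Fin numReg)
  xReg : Fin numReg
  yReg : Fin numReg
  zReg : Fin numReg

/-- The slacks `(A p) i - 1` of the vector `p` that the agents play. -/
def Protocol.slack (P : Protocol) {m n : ℕ} (A : Matrix (Fin m) (Fin n) ℝ)
    (s : Fin n → Fin P.numReg → ℝ) (i : Fin m) : ℝ :=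
  (A *ᵥ fun j => P.play.eval (s j)) i - 1

/-- The registers of all agents after one more round. -/
def Protocol.round (P : Protocol) {m n : ℕ} (A : Matrix (Fin m) (Fin n) ℝ)
    (s : Fin n → Fin P.numReg → ℝ) : Fin n → Fin P.numReg → ℝ :=
  fun j q => (P.finish q).eval
    ((incident A j).foldl
      (fun r i q' => (P.absorb q').eval (Sum.elim r ![A i j, P.slack A s i])) (s j))

/-- The registers of all agents after `k` rounds. -/
def Protocol.state (P : Protocol) {m n : ℕ} (A : Matrix (Fin m) (Fin n) ℝ) (ε : ℝ) :
    ℕ → Fin n → Fin P.numReg → ℝ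
  | 0 => fun _ q => (P.start q).eval ![(m : ℝ), (n : ℝ), ε]
  | k + 1 => P.round A (P.state A ε k)

/-- The total number of operations of one round: the slack of constraint `i` takes one
multiplication and one addition or subtraction for each nonzero entry of row `i`; each agent
evaluates `play`, `absorb` once per incident constraint, `finish` and `halt`. -/
def Protocol.roundCost (P : Protocol) {m n : ℕ} (A : Matrix (Fin m) (Fin n) ℝ) : ℕ :=
  ∑ i, 2 * rowNonzeros A i +
    ∑ j, (P.play.cost + (incident A j).length * ∑ q, (P.absorb q).cost +
      ∑ q, (P.finish q).cost + P.halt.cost)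

end FairPacking

end

noncomputable section
namespace FairPacking

/-! ### Convexity and local smoothness of the regularized objective -/

/-! Write `p = (1 + β) / β`. Since `β / (1 + β) = p⁻¹`, the regularized objective is the convex
function `-∑ x_j + p⁻¹ ∑ (A exp x)_i ^ p`, whose partial derivatives are all at least `-1` but have
no useful upper bound. Its second-order error along a short step `d` is at most `p ∑ (∂_j + 1) d_j²`
(`powObjective_add_le`), so a coordinate is rough only where its own derivative is large. A step of
length at most `|min(1, ∂_j)| / (4p)` in coordinate `j` against the truncated gradient therefore
still realizes half of its first-order decrease, and this decrease is measured with the full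
gradient (`powObjective_descent`). No entry ratio of `A` appears, hence no width.

Each iteration couples such a descent step with a projected mirror step. Mirror descent sees only
the truncated gradient. The loss from the discarded part `∂_j - 1` is paid by the descent step,
because wherever truncation occurs the mirror step moves down by at least `η (z_j - u_j)`
(`mirror_coordinate_le`). Hence the potential `3 L η_k (f_r(y_k) - f_r(u)) + ‖z_k - u‖² / (2ω)`
never increases (`IsStep.potential_le`). As `3 L η_k = (1 - τ)^(-k)`, the choice of `T` makes the
final weight at least `4 n log(2mn) / ε`, which exceeds the initial potential divided by `ε`.

Two facts transfer this to fair packing. A point with regularized value at most that of the start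
plus `ε` violates no constraint by more than a factor `1 + ε/n`, as the power `p` would otherwise
make the penalty too large (`le_one_add_of_rpow_le`). Conversely, every coordinate of the fair
solution is at least `1/n`, so the logarithm of its copy shrunk by `1 - ε/n` lies in the box and has
a small penalty (`IsFairSolution.exists_mem_box`). The losses are `3ε` for shrinking and penalty,
`ε` for optimization and `ε` for the final rescaling.

For the distributed claim, the update of agent `j` needs only its own iterates and a sum over
incident rows of powers of slack plus one, so a constant number of registers suffices. -/

/-- The regularized objective with exponent `p`. -/
def powObjective {m n : ℕ} (A : Matrix (Fin m) (Fin n) ℝ) (p : ℝ) (x : Fin n → ℝ) : ℝ :=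
  -∑ j, x j + p⁻¹ * ∑ i, (A *ᵥ expVec x) i ^ p

/-- The gradient of `powObjective`. -/
def powGrad {m n : ℕ} (A : Matrix (Fin m) (Fin n) ℝ) (p : ℝ) (x : Fin n → ℝ) (j : Fin n) : ℝ :=
  -1 + ∑ i, (A *ᵥ expVec x) i ^ (p - 1) * (A i j * Real.exp (x j))

variable {m n : ℕ} {A : Matrix (Fin m) (Fin n) ℝ} {p : ℝ} {x : Fin n → ℝ}

lemma mulVec_expVec (A : Matrix (Fin m) (Fin n) ℝ) (x : Fin n → ℝ) (i : Fin m) :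
    (A *ᵥ expVec x) i = ∑ j, A i j * Real.exp (x j) := rfl

lemma mulVec_expVec_nonneg (hA : ∀ i j, 0 ≤ A i j) (x : Fin n → ℝ) (i : Fin m) :
    0 ≤ (A *ᵥ expVec x) i := by
  rw [mulVec_expVec]
  exact Finset.sum_nonneg fun j _ => mul_nonneg (hA i j) (Real.exp_pos _).le

lemma powGrad_add_one (A : Matrix (Fin m) (Fin n) ℝ) (p : ℝ) (x : Fin n → ℝ) (j : Fin n) :
    powGrad A p x j + 1 = ∑ i, (A *ᵥ expVec x) i ^ (p - 1) * (A i j * Real.exp (x j)) := by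
  unfold powGrad; ring

lemma powGrad_add_one_nonneg (hA : ∀ i j, 0 ≤ A i j) (p : ℝ) (x : Fin n → ℝ) (j : Fin n) :
    0 ≤ powGrad A p x j + 1 := by
  rw [powGrad_add_one]
  exact Finset.sum_nonneg fun i _ => mul_nonneg
    (Real.rpow_nonneg (mulVec_expVec_nonneg hA x i) _) (mul_nonneg (hA i j) (Real.exp_pos _).le)

/-- Exchanging the summation over rows and columns in a weighted sum of gradient entries. -/
lemma sum_powGrad_add_one_mul (A : Matrix (Fin m) (Fin n) ℝ) (p : ℝ) (x c : Fin n → ℝ) :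
    ∑ j, (powGrad A p x j + 1) * c j =
      ∑ i, (A *ᵥ expVec x) i ^ (p - 1) * ∑ j, A i j * Real.exp (x j) * c j := by
  simp_rw [powGrad_add_one, Finset.sum_mul, Finset.mul_sum]
  rw [Finset.sum_comm]
  exact Finset.sum_congr rfl fun i _ => Finset.sum_congr rfl fun j _ => by ring

lemma rpow_tangent_le {a b : ℝ} (hp : 1 < p) (ha : 0 ≤ a) (hb : 0 ≤ b) :
    a ^ p + p * (a ^ (p - 1) * (b - a)) ≤ b ^ p := by
  rcases ha.eq_or_lt with rfl | ha
  · rw [Real.zero_rpow (by linarith), Real.zero_rpow (by linarith)]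
    simpa using Real.rpow_nonneg hb p
  · have h := one_add_mul_self_le_rpow_one_add (s := b / a - 1)
      (by have := div_nonneg hb ha.le; linarith) hp.le
    have hap : 0 < a ^ p := Real.rpow_pos_of_pos ha p
    rw [show 1 + (b / a - 1) = b / a by ring, Real.div_rpow hb ha.le, le_div_iff₀ hap] at h
    refine le_trans (le_of_eq ?_) h
    rw [Real.rpow_sub_one ha.ne']
    field_simp

/-- First-order convexity of the objective. -/
lemma powObjective_tangent_le (hA : ∀ i j, 0 ≤ A i j) (hp : 1 < p) (x u : Fin n → ℝ) :
    powObjective A p x + ∑ j, powGrad A p x j * (u j - x j) ≤ powObjective A p u := by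
  have key : ∑ i, (A *ᵥ expVec x) i ^ p + p * ∑ j, (powGrad A p x j + 1) * (u j - x j) ≤
      ∑ i, (A *ᵥ expVec u) i ^ p := by
    rw [sum_powGrad_add_one_mul, Finset.mul_sum, ← Finset.sum_add_distrib]
    refine Finset.sum_le_sum fun i _ => ?_
    refine le_trans ?_ (rpow_tangent_le hp (mulVec_expVec_nonneg hA x i)
      (mulVec_expVec_nonneg hA u i))
    gcongr
    · exact Real.rpow_nonneg (mulVec_expVec_nonneg hA x i) _
    · rw [mulVec_expVec, mulVec_expVec, ← Finset.sum_sub_distrib]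
      refine Finset.sum_le_sum fun j _ => ?_
      have h1 : Real.exp (u j) = Real.exp (x j) * Real.exp (u j - x j) := by
        rw [← Real.exp_add]; congr 1; ring
      have h2 := Real.add_one_le_exp (u j - x j)
      have h3 := mul_le_mul_of_nonneg_left h2 (mul_nonneg (hA i j) (Real.exp_pos (x j)).le)
      rw [h1]; linarith
  have hp0 : 0 < p := by linarith
  have h4 := mul_le_mul_of_nonneg_left key (inv_pos.2 hp0).le
  rw [mul_add, inv_mul_cancel_left₀ hp0.ne'] at h4
  simp only [add_mul, one_mul, Finset.sum_add_distrib, Finset.sum_sub_distrib] at h4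
  unfold powObjective
  linarith

/-- Jensen for `t ↦ t ^ p` with weights `a_j / ∑ a`. It decouples the coordinates of a step, so that
the smoothness bound becomes diagonal. -/
lemma sum_mul_exp_rpow_le {a d : Fin n → ℝ} (ha : ∀ j, 0 ≤ a j) (hp : 1 < p) :
    (∑ j, a j * Real.exp (d j)) ^ p ≤ (∑ j, a j) ^ (p - 1) * ∑ j, a j * Real.exp (p * d j) := by
  rcases (Finset.sum_nonneg fun j _ => ha j : 0 ≤ ∑ j, a j).eq_or_lt with h | h
  · have h0 : ∀ j, a j = 0 := fun j =>
      (Finset.sum_eq_zero_iff_of_nonneg fun j _ => ha j).1 h.symm j (Finset.mem_univ j)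
    simp [h0, Real.zero_rpow (by linarith : p ≠ 0)]
  · set s := ∑ j, a j
    have hJ := Real.rpow_arith_mean_le_arith_mean_rpow Finset.univ (fun j => a j / s)
      (fun j => Real.exp (d j)) (fun j _ => div_nonneg (ha j) h.le)
      (by rw [← Finset.sum_div]; exact div_self h.ne') (fun j _ => (Real.exp_pos _).le) hp.le
    have e1 : ∑ j, a j / s * Real.exp (d j) = (∑ j, a j * Real.exp (d j)) / s := by
      rw [Finset.sum_div]; exact Finset.sum_congr rfl fun j _ => by ring
    have e2 : ∑ j, a j / s * Real.exp (d j) ^ p = (∑ j, a j * Real.exp (p * d j)) / s := by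
      rw [Finset.sum_div]
      refine Finset.sum_congr rfl fun j _ => ?_
      rw [← Real.exp_mul, mul_comm (d j)]; ring
    rw [e1, e2, Real.div_rpow (Finset.sum_nonneg fun j _ => mul_nonneg (ha j) (Real.exp_pos _).le)
      h.le, div_le_iff₀ (Real.rpow_pos_of_pos h p)] at hJ
    refine hJ.trans (le_of_eq ?_)
    rw [Real.rpow_sub_one h.ne']; ring

/-- Local smoothness of the objective. -/
lemma powObjective_add_le (hA : ∀ i j, 0 ≤ A i j) (hp : 1 < p) (x d : Fin n → ℝ)
    (hd : ∀ j, |p * d j| ≤ 1) :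
    powObjective A p (x + d) ≤ powObjective A p x + ∑ j, powGrad A p x j * d j +
      p * ∑ j, (powGrad A p x j + 1) * d j ^ 2 := by
  have hp0 : 0 < p := by linarith
  have h1 : ∑ i, (A *ᵥ expVec (x + d)) i ^ p ≤
      ∑ j, (powGrad A p x j + 1) * Real.exp (p * d j) := by
    rw [sum_powGrad_add_one_mul]
    refine Finset.sum_le_sum fun i _ => ?_
    have := sum_mul_exp_rpow_le (a := fun j => A i j * Real.exp (x j)) (d := d)
      (fun j => mul_nonneg (hA i j) (Real.exp_pos _).le) hp
    simpa [mulVec_expVec, Real.exp_add, mul_assoc] using this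
  have h0 : ∑ i, (A *ᵥ expVec x) i ^ p = ∑ j, (powGrad A p x j + 1) := by
    have := sum_powGrad_add_one_mul A p x (fun _ => 1)
    simp only [mul_one] at this
    rw [this]
    refine Finset.sum_congr rfl fun i _ => ?_
    rw [← mulVec_expVec]
    rcases (mulVec_expVec_nonneg hA x i).eq_or_lt with h | h
    · rw [← h, Real.zero_rpow hp0.ne', mul_zero]
    · rw [Real.rpow_sub_one h.ne', div_mul_cancel₀ _ h.ne']
  have h2 : ∑ j, (powGrad A p x j + 1) * Real.exp (p * d j) ≤
      ∑ j, (powGrad A p x j + 1) + p * (∑ j, (powGrad A p x j + 1) * d j +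
        p * ∑ j, (powGrad A p x j + 1) * d j ^ 2) := by
    rw [Finset.mul_sum, ← Finset.sum_add_distrib, Finset.mul_sum, ← Finset.sum_add_distrib]
    -- Coordinatewise, `exp t ≤ 1 + t + t²` for `|t| ≤ 1`, applied at `t = p d_j`.
    refine Finset.sum_le_sum fun j _ => ?_
    have h3 := (abs_le.1 (Real.abs_exp_sub_one_sub_id_le (hd j))).2
    have h4 := mul_le_mul_of_nonneg_left h3 (powGrad_add_one_nonneg hA p x j)
    nlinarith
  have h5 := mul_le_mul_of_nonneg_left (h1.trans h2) (inv_pos.2 hp0).le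
  rw [mul_add, inv_mul_cancel_left₀ hp0.ne', ← h0] at h5
  simp only [add_mul, one_mul, Finset.sum_add_distrib, mul_add] at h5
  unfold powObjective
  simp only [Pi.add_apply, Finset.sum_add_distrib, add_mul, mul_add, one_mul]
  linarith

/-- A step against the truncated gradient makes progress proportional to its first-order change. -/
lemma powObjective_descent (hA : ∀ i j, 0 ≤ A i j) (hp : 1 < p) (x d : Fin n → ℝ)
    (hsign : ∀ j, min 1 (powGrad A p x j) * d j ≤ 0)
    (hd : ∀ j, 4 * p * |d j| ≤ |min 1 (powGrad A p x j)|) :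
    powObjective A p (x + d) ≤ powObjective A p x + 1 / 2 * ∑ j, powGrad A p x j * d j := by
  have hp0 : 0 < p := by linarith
  have habs : ∀ j, |min 1 (powGrad A p x j)| ≤ 1 := fun j => by
    have := powGrad_add_one_nonneg hA p x j
    exact abs_le.2 ⟨le_min (by norm_num) (by linarith), min_le_left _ _⟩
  have h1 := powObjective_add_le hA hp x d fun j => by
    rw [abs_mul, abs_of_pos hp0]
    have := hd j; have := habs j; have := mul_nonneg hp0.le (abs_nonneg (d j))
    linarith
  have h2 : p * ∑ j, (powGrad A p x j + 1) * d j ^ 2 ≤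
      -(1 / 2) * ∑ j, powGrad A p x j * d j := by
    rw [Finset.mul_sum, Finset.mul_sum]
    refine Finset.sum_le_sum fun j _ => ?_
    have hg := powGrad_add_one_nonneg hA p x j
    have hs := hsign j
    have hdj := hd j
    set G := powGrad A p x j
    have hsq : 4 * p * d j ^ 2 ≤ |min 1 G| * |d j| := by
      have := mul_le_mul_of_nonneg_right hdj (abs_nonneg (d j))
      rw [← sq_abs (d j)]; linarith
    rw [← abs_mul, abs_of_nonpos hs] at hsq
    have h3 := mul_le_mul_of_nonneg_left hsq hg
    -- Truncation cancels the growth of the curvature: `G + 1 ≤ 2G` if `G ≥ 1`, and `G + 1 ≤ 2`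
    -- otherwise.
    have h4 : (G + 1) * -(min 1 G * d j) ≤ 2 * -(G * d j) := by
      rcases le_total 1 G with h | h
      · rw [min_eq_left h] at hs ⊢
        nlinarith
      · rw [min_eq_right h] at hs ⊢
        nlinarith
    linarith
  linarith

/-- A row with entry `1` in column `j` alone contributes at least `exp (p x_j)` to the gradient.
Thus the gradient is only slightly negative when `x_j` is just below `0`, which keeps descent steps
from crossing `0`. -/
lemma exp_mul_sub_one_le_powGrad (hA : Normalized A) (hp : 1 < p) (x : Fin n → ℝ) (j : Fin n) :
    Real.exp (p * x j) - 1 ≤ powGrad A p x j := by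
  obtain ⟨i, hi⟩ := (hA.2 j).1
  have hi : A i j = 1 := hi
  have h1 : Real.exp (x j) ≤ (A *ᵥ expVec x) i := by
    have := Finset.single_le_sum (f := fun j => A i j * Real.exp (x j))
      (fun k _ => mul_nonneg (hA.1 i k) (Real.exp_pos _).le) (Finset.mem_univ j)
    simpa [hi, mulVec_expVec] using this
  have h2 : Real.exp (p * x j) ≤ (A *ᵥ expVec x) i ^ (p - 1) * (A i j * Real.exp (x j)) := by
    rw [hi, one_mul, show p * x j = x j * (p - 1) + x j by ring, Real.exp_add, Real.exp_mul]
    gcongr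
  have h3 := h2.trans (Finset.single_le_sum
    (f := fun i => (A *ᵥ expVec x) i ^ (p - 1) * (A i j * Real.exp (x j)))
    (fun k _ => mul_nonneg (Real.rpow_nonneg (mulVec_expVec_nonneg hA.1 x k) _)
      (mul_nonneg (hA.1 k j) (Real.exp_pos _).le)) (Finset.mem_univ i))
  rw [← powGrad_add_one] at h3
  linarith

lemma hasDerivAt_powObjective (hp : 1 < p) (A : Matrix (Fin m) (Fin n) ℝ) (x : Fin n → ℝ)
    (j : Fin n) :
    HasDerivAt (fun t => powObjective A p (Function.update x j t)) (powGrad A p x j) (x j) := by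
  have hu : ∀ k, HasDerivAt (fun t => Function.update x j t k) (if k = j then 1 else 0) (x j) := by
    intro k
    by_cases h : k = j
    · subst h; simpa using hasDerivAt_id' (x k)
    · simpa [h] using hasDerivAt_const (x j) (x k)
  have hq : ∀ i, HasDerivAt (fun t => (A *ᵥ expVec (Function.update x j t)) i)
      (A i j * Real.exp (x j)) (x j) := by
    intro i
    have h := HasDerivAt.fun_sum (u := Finset.univ) fun k _ => ((hu k).exp.const_mul (A i k))
    simpa [mulVec_expVec] using h
  have h1 := (HasDerivAt.fun_sum (u := Finset.univ) fun k _ => hu k).neg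
  have h2 := (HasDerivAt.fun_sum (u := Finset.univ) fun i _ =>
    (hq i).rpow_const (p := p) (Or.inr hp.le)).const_mul p⁻¹
  have h3 := h1.add h2
  refine h3.congr_deriv ?_
  simp only [Function.update_eq_self, Finset.sum_ite_eq', Finset.mem_univ, if_true, powGrad]
  rw [Finset.mul_sum]
  congr 1
  refine Finset.sum_congr rfl fun i _ => ?_
  have : p ≠ 0 := by linarith
  field_simp

end FairPacking
end

noncomputable section
namespace FairPacking

/-! ### One iteration of the accelerated method -/

/-- A scaled gradient step from `z`, projected to the interval `[-ω, 0]`. -/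
def boxStep (ω η g z : ℝ) : ℝ := max (-ω) (min 0 (z - ω * η * g))

lemma boxStep_mem {ω : ℝ} (hω : 0 < ω) (η g z : ℝ) : boxStep ω η g z ∈ Set.Icc (-ω) 0 :=
  ⟨le_max_left _ _, max_le (by linarith) (min_le_left _ _)⟩

/-- The clipped point satisfies the variational inequality of a projection (`key`); the remaining
terms are the exact quadratic expansion around it. This gives both optimality of the mirror step and
the telescoping distance terms. -/
lemma boxStep_quadratic_growth {ω η g z w : ℝ} (hω : 0 < ω) (hw : w ∈ Set.Icc (-ω) 0) :
    1 / (2 * ω) * (boxStep ω η g z - z) ^ 2 + η * g * boxStep ω η g z +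
      1 / (2 * ω) * (w - boxStep ω η g z) ^ 2 ≤ 1 / (2 * ω) * (w - z) ^ 2 + η * g * w := by
  obtain ⟨h1, h2⟩ := hw
  have key : 0 ≤ (boxStep ω η g z - (z - ω * η * g)) * (w - boxStep ω η g z) := by
    unfold boxStep
    rcases le_total 0 (z - ω * η * g) with h | h
    · rw [min_eq_left h, max_eq_right (by linarith)]; nlinarith
    · rw [min_eq_right h]
      rcases le_total (-ω) (z - ω * η * g) with h' | h'
      · rw [max_eq_right h']; simp
      · rw [max_eq_left h']; nlinarith
  set c := boxStep ω η g z
  have e : 1 / (2 * ω) * (w - z) ^ 2 + η * g * w - (1 / (2 * ω) * (c - z) ^ 2 + η * g * c +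
      1 / (2 * ω) * (w - c) ^ 2) = 1 / ω * ((c - (z - ω * η * g)) * (w - c)) := by
    field_simp; ring
  have := mul_nonneg (one_div_pos.2 hω).le key
  linarith

lemma boxStep_sub_mul_nonpos {ω η g z : ℝ} (hω : 0 < ω) (hη : 0 < η) (hz : z ∈ Set.Icc (-ω) 0) :
    g * (boxStep ω η g z - z) ≤ 0 := by
  obtain ⟨h1, h2⟩ := hz
  have hωη := mul_pos hω hη
  unfold boxStep
  rcases le_total 0 g with h | h
  · have h3 := mul_nonneg hωη.le h
    exact mul_nonpos_of_nonneg_of_nonpos h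
      (sub_nonpos.2 (max_le h1 ((min_le_right _ _).trans (by linarith))))
  · have h3 := mul_nonpos_of_nonneg_of_nonpos hωη.le h
    exact mul_nonpos_of_nonpos_of_nonneg h
      (sub_nonneg.2 (le_max_of_le_right (le_min h2 (by linarith))))

lemma abs_boxStep_sub_le {ω η g z : ℝ} (hω : 0 < ω) (hη : 0 < η) (hz : z ∈ Set.Icc (-ω) 0) :
    |boxStep ω η g z - z| ≤ ω * η * |g| := by
  obtain ⟨h1, h2⟩ := hz
  have hωη := mul_pos hω hη
  unfold boxStep
  rcases le_total 0 g with h | h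
  · have h3 := mul_nonneg hωη.le h
    rw [abs_of_nonneg h, min_eq_right (by linarith), abs_le]
    exact ⟨by linarith [le_max_right (-ω) (z - ω * η * g)],
      by linarith [max_le h1 (by linarith : z - ω * η * g ≤ z)]⟩
  · have h3 := mul_nonpos_of_nonneg_of_nonpos hωη.le h
    rw [abs_of_nonpos h, max_eq_right (le_min (by linarith) (by linarith)), abs_le]
    exact ⟨by linarith [le_min h2 (by linarith : z ≤ z - ω * η * g)],
      by linarith [min_le_right 0 (z - ω * η * g)]⟩

/-- The step with gradient `1` goes down by `ωη`, or by `z + ω` if it hits the wall. Since `z - u ≤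
z + ω ≤ ω` and `η ≤ 1`, either amount is at least `η (z - u)`. -/
lemma mul_sub_le_sub_boxStep_one {ω η z u : ℝ} (hη : 0 < η) (hη1 : η ≤ 1)
    (hz : z ∈ Set.Icc (-ω) 0) (hu : u ∈ Set.Icc (-ω) 0) (hω : 0 < ω) :
    η * (z - u) ≤ z - boxStep ω η 1 z := by
  obtain ⟨h1, h2⟩ := hz
  obtain ⟨h3, h4⟩ := hu
  have hωη := mul_pos hω hη
  have : boxStep ω η 1 z ≤ z - η * (z - u) := by
    unfold boxStep
    rw [min_eq_right (by linarith)]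
    exact max_le (by nlinarith) (by nlinarith)
  linarith

/-- The mirror step charges the loss of a coordinate to its first-order progress. -/
lemma mirror_coordinate_le {ω η G z u : ℝ} (hω : 0 < ω) (hη : 0 < η) (hη1 : η ≤ 1)
    (hz : z ∈ Set.Icc (-ω) 0) (hu : u ∈ Set.Icc (-ω) 0) :
    η * (G * (z - u)) ≤ G * (z - boxStep ω η (min 1 G) z) + 1 / (2 * ω) * (z - u) ^ 2 -
      1 / (2 * ω) * (boxStep ω η (min 1 G) z - u) ^ 2 := by
  have h1 := boxStep_quadratic_growth (η := η) (g := min 1 G) (z := z) hω hu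
  have h2 := boxStep_sub_mul_nonpos (g := min 1 G) hω hη hz
  -- The truncated excess, invisible to mirror descent, is charged to the actual movement of `z`.
  have h3 : η * ((G - min 1 G) * (z - u)) ≤ (G - min 1 G) * (z - boxStep ω η (min 1 G) z) := by
    rcases le_total 1 G with h | h
    · have h4 := mul_sub_le_sub_boxStep_one hη hη1 hz hu hω
      have h5 := mul_le_mul_of_nonneg_left h4 (sub_nonneg.2 h)
      rw [min_eq_left h]; linarith
    · simp [min_eq_right h]
  set g := min 1 G
  set c := boxStep ω η g z
  have h6 : η * (g * (z - c)) ≤ g * (z - c) := by nlinarith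
  have h7 : 0 ≤ 1 / (2 * ω) * (c - z) ^ 2 := by positivity
  have e1 : (z - u) ^ 2 = (u - z) ^ 2 := by ring
  have e2 : (c - u) ^ 2 = (u - c) ^ 2 := by ring
  rw [e1, e2]
  linarith

variable {m n : ℕ} {A : Matrix (Fin m) (Fin n) ℝ} {p ω L τ η : ℝ} {x y y' z z' u : Fin n → ℝ}

/-- One iteration of the accelerated method from `(y', z')` to `(x, y, z)`. -/
structure IsStep (A : Matrix (Fin m) (Fin n) ℝ) (p ω L τ η : ℝ) (y' z' x y z : Fin n → ℝ) :
    Prop where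
  coupling : x = τ • z' + (1 - τ) • y'
  mirror : ∀ j, z j = boxStep ω η (min 1 (powGrad A p x j)) (z' j)
  descent : y = x + (1 / (η * L)) • (z - z')

lemma IsStep.sign (h : IsStep A p ω L τ η y' z' x y z) (hω : 0 < ω) (hη : 0 < η)
    (hz : ∀ j, z' j ∈ Set.Icc (-ω) 0) (j : Fin n) :
    min 1 (powGrad A p x j) * (z j - z' j) ≤ 0 := by
  rw [h.mirror j]; exact boxStep_sub_mul_nonpos hω hη (hz j)

lemma IsStep.length (h : IsStep A p ω L τ η y' z' x y z) (hp : 1 < p) (hω : 0 < ω) (hη : 0 < η)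
    (hL : 4 * ω * p ≤ L) (hz : ∀ j, z' j ∈ Set.Icc (-ω) 0) (j : Fin n) :
    4 * p * |1 / (η * L) * (z j - z' j)| ≤ |min 1 (powGrad A p x j)| := by
  have hp0 : 0 < p := by linarith
  have hL0 : 0 < L := by have : 0 < 4 * ω * p := by positivity
                         linarith
  rw [h.mirror j, abs_mul, abs_of_pos (by positivity)]
  have h1 := abs_boxStep_sub_le (g := min 1 (powGrad A p x j)) hω hη (hz j)
  set b := |min 1 (powGrad A p x j)|
  have hb : 0 ≤ b := abs_nonneg _
  calc _ ≤ 4 * p * (1 / (η * L) * (ω * η * b)) := by gcongr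
    _ = 4 * ω * p / L * b := by field_simp
    _ ≤ 1 * b := by gcongr; exact (div_le_one hL0).2 hL
    _ = b := one_mul b

lemma IsStep.objective_le (h : IsStep A p ω L τ η y' z' x y z) (hA : ∀ i j, 0 ≤ A i j)
    (hp : 1 < p) (hω : 0 < ω) (hη : 0 < η) (hL : 4 * ω * p ≤ L)
    (hz : ∀ j, z' j ∈ Set.Icc (-ω) 0) :
    ∑ j, powGrad A p x j * (z' j - z j) ≤
      2 * (η * L) * (powObjective A p x - powObjective A p y) := by
  have hL0 : 0 < L := by have : 0 < 4 * ω * p := by have : 0 < p := by linarith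
                                                    positivity
                         linarith
  have h1 := powObjective_descent hA hp x ((1 / (η * L)) • (z - z'))
    (fun j => by
      have := h.sign hω hη hz j
      have h2 : 0 ≤ 1 / (η * L) := by positivity
      simp only [Pi.smul_apply, Pi.sub_apply, smul_eq_mul]
      nlinarith)
    (fun j => by simpa using h.length hp hω hη hL hz j)
  rw [← h.descent] at h1
  have e : ∑ j, powGrad A p x j * ((1 / (η * L)) • (z - z')) j =
      -(1 / (η * L) * ∑ j, powGrad A p x j * (z' j - z j)) := by
    rw [Finset.mul_sum, ← Finset.sum_neg_distrib]
    refine Finset.sum_congr rfl fun j _ => ?_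
    simp only [Pi.smul_apply, Pi.sub_apply, smul_eq_mul]; ring
  rw [e] at h1
  set S := ∑ j, powGrad A p x j * (z' j - z j)
  have hηL : 0 < η * L := by positivity
  have e2 : S = η * L * (1 / (η * L) * S) := by field_simp
  rw [e2]
  nlinarith

/-- The potential decreases in one iteration. -/
lemma IsStep.potential_le (h : IsStep A p ω L τ η y' z' x y z) (hA : ∀ i j, 0 ≤ A i j)
    (hp : 1 < p) (hω : 0 < ω) (hη : 0 < η) (hη1 : η ≤ 1) (hL : 4 * ω * p ≤ L)
    (hτ : 3 * L * τ = 1) (hτ1 : τ ≤ 1) (hz : ∀ j, z' j ∈ Set.Icc (-ω) 0)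
    (hu : ∀ j, u j ∈ Set.Icc (-ω) 0) :
    3 * L * η * (powObjective A p y - powObjective A p u) +
        1 / (2 * ω) * ∑ j, (z j - u j) ^ 2 ≤
      3 * L * ((1 - τ) * η) * (powObjective A p y' - powObjective A p u) +
        1 / (2 * ω) * ∑ j, (z' j - u j) ^ 2 := by
  have hL0 : 0 < L := by have : 0 < 4 * ω * p := by have : 0 < p := by linarith
                                                    positivity
                         linarith
  have hdesc := h.objective_le hA hp hω hη hL hz
  have hnn : 0 ≤ ∑ j, powGrad A p x j * (z' j - z j) := by
    refine Finset.sum_nonneg fun j _ => ?_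
    have h1 := h.sign hω hη hz j
    rcases le_total 1 (powGrad A p x j) with hg | hg
    · rw [min_eq_left hg] at h1
      exact mul_nonneg (by linarith) (by linarith)
    · rw [min_eq_right hg] at h1; linarith
  have hmirror : η * ∑ j, powGrad A p x j * (z' j - u j) ≤
      ∑ j, powGrad A p x j * (z' j - z j) + 1 / (2 * ω) * ∑ j, (z' j - u j) ^ 2 -
        1 / (2 * ω) * ∑ j, (z j - u j) ^ 2 := by
    rw [Finset.mul_sum, Finset.mul_sum, Finset.mul_sum, ← Finset.sum_add_distrib,
      ← Finset.sum_sub_distrib]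
    refine Finset.sum_le_sum fun j _ => ?_
    rw [h.mirror j]
    exact mirror_coordinate_le hω hη hη1 (hz j) (hu j)
  have hcu := powObjective_tangent_le hA hp x u
  have hcy := powObjective_tangent_le hA hp x y'
  have hsplit : ∑ j, powGrad A p x j * (u j - x j) =
      -(∑ j, powGrad A p x j * (z' j - u j)) -
        3 * L * (1 - τ) * ∑ j, powGrad A p x j * (y' j - x j) := by
    rw [Finset.mul_sum, ← Finset.sum_neg_distrib, ← Finset.sum_sub_distrib]
    refine Finset.sum_congr rfl fun j _ => ?_
    have hx : x j = τ * z' j + (1 - τ) * y' j := by rw [h.coupling]; simp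
    -- As `3L = 1/τ`, the coupling turns the displacement `x - z'` into a multiple of `y' - x`,
    -- where convexity towards `y'` applies.
    have h3 : 3 * L * (1 - τ) * (y' j - x j) = x j - z' j := by
      have e : (1 - τ) * (y' j - x j) = τ * (x j - z' j) := by rw [hx]; ring
      rw [mul_assoc, e, ← mul_assoc, hτ, one_mul]
    have : 3 * L * (1 - τ) * (powGrad A p x j * (y' j - x j)) =
      powGrad A p x j * (x j - z' j) := by rw [← h3]; ring
    rw [this]; ring
  rw [hsplit] at hcu
  set Fx := powObjective A p x
  set Fy := powObjective A p y
  set Fy' := powObjective A p y'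
  set Fu := powObjective A p u
  set S := ∑ j, powGrad A p x j * (z' j - z j)
  set V := ∑ j, powGrad A p x j * (z' j - u j)
  set W := ∑ j, powGrad A p x j * (y' j - x j)
  have hηL : 0 < η * L := by positivity
  -- Descent gives the factor `2ηL`; nonnegative progress allows weakening it to `3ηL`, exactly the
  -- coefficient that cancels `Fx`.
  have hxy : 0 ≤ η * L * (Fx - Fy) := by nlinarith
  have hcoef : 0 ≤ η * (3 * L * (1 - τ)) := by
    have : 0 ≤ 1 - τ := by linarith
    positivity
  have h1 := mul_le_mul_of_nonneg_left hcy hcoef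
  have h2 := mul_le_mul_of_nonneg_left hcu hη.le
  have e1 : 3 * L * (1 - τ) = 3 * L - 1 := by rw [mul_sub, hτ]; ring
  rw [show 3 * L * ((1 - τ) * η) = (3 * L * (1 - τ)) * η by ring, e1]
  rw [e1] at h1 h2
  linarith

/-- The gradient step does not leave the nonpositive orthant. -/
lemma IsStep.descent_nonpos (h : IsStep A p ω L τ η y' z' x y z) (hA : Normalized A)
    (hp : 1 < p) (hω : 0 < ω) (hη : 0 < η) (hL : 4 * ω * p ≤ L) (hτ0 : 0 ≤ τ) (hτ1 : τ ≤ 1)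
    (hz : ∀ j, z' j ∈ Set.Icc (-ω) 0) (hy : ∀ j, y' j ≤ 0) (j : Fin n) : y j ≤ 0 := by
  have hp0 : 0 < p := by linarith
  have hL0 : 0 < L := by have : 0 < 4 * ω * p := by positivity
                         linarith
  have hx : x j ≤ 0 := by
    have : x j = τ * z' j + (1 - τ) * y' j := by rw [h.coupling]; simp
    have h1 := mul_nonpos_of_nonneg_of_nonpos hτ0 (hz j).2
    have h2 := mul_nonpos_of_nonneg_of_nonpos (sub_nonneg.2 hτ1) (hy j)
    linarith
  have hyj : y j = x j + 1 / (η * L) * (z j - z' j) := by rw [h.descent]; simp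
  have hlen := h.length hp hω hη hL hz j
  have hsign := h.sign hω hη hz j
  have hg : p * x j ≤ min 1 (powGrad A p x j) := by
    refine le_min ?_ ?_
    · have := mul_nonpos_of_nonneg_of_nonpos hp0.le hx
      linarith
    · have h1 := exp_mul_sub_one_le_powGrad hA hp x j
      have h2 := Real.add_one_le_exp (p * x j)
      linarith
  set g := min 1 (powGrad A p x j)
  have hc : 0 < 1 / (η * L) := by positivity
  rcases lt_or_ge 0 g with hg0 | hg0
  · have h3 : z j - z' j ≤ 0 := by
      by_contra hcon
      have := mul_pos hg0 (not_le.1 hcon)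
      linarith
    have := mul_nonpos_of_nonneg_of_nonpos hc.le h3
    linarith
  · rw [abs_of_nonpos hg0] at hlen
    have h4 := le_abs_self (1 / (η * L) * (z j - z' j))
    have h5 := abs_nonneg (1 / (η * L) * (z j - z' j))
    rw [hyj]
    -- Upward moves have length at most `|g| / (4p)`, and `|g| ≤ p |x_j|`, so they cover at most a
    -- quarter of the distance to `0`.
    have : p * |1 / (η * L) * (z j - z' j)| ≤ p * -x j := by nlinarith
    have := le_of_mul_le_mul_left this hp0
    linarith

end FairPacking
end

noncomputable section
namespace FairPacking

/-! ### The parameters, and the regularized objective along a run -/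

/-- The exponent `(1 + β) / β` of the regularized objective. -/
def expo (m n : ℕ) (ε : ℝ) : ℝ := (1 + beta m n ε) / beta m n ε

lemma regObjective_eq {m n : ℕ} (A : Matrix (Fin m) (Fin n) ℝ) (ε : ℝ) :
    regObjective A ε = powObjective A (expo m n ε) := by
  funext x; simp [regObjective, powObjective, expo]

/-- The admissible parameters. -/
structure Admissible (m n : ℕ) (ε : ℝ) : Prop where
  m_pos : 1 ≤ m
  n_pos : 1 ≤ n
  ε_pos : 0 < ε
  ε_le : ε ≤ (n : ℝ) / 2

lemma Normalized.admissible {m n : ℕ} {A : Matrix (Fin m) (Fin n) ℝ} {ε : ℝ} (hA : Normalized A)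
    (h0 : 0 < ε) (h1 : ε ≤ (n : ℝ) / 2) : Admissible m n ε := by
  have hn : 1 ≤ n := by
    rcases Nat.eq_zero_or_pos n with rfl | h
    · norm_num at h1; linarith
    · exact h
  refine ⟨?_, hn, h0, h1⟩
  obtain ⟨i, -⟩ := (hA.2 ⟨0, hn⟩).1
  exact (Nat.zero_le _).trans_lt i.isLt

namespace Admissible

variable {m n : ℕ} {ε : ℝ}

lemma one_le_m (h : Admissible m n ε) : (1 : ℝ) ≤ m := by exact_mod_cast h.m_pos

lemma one_le_n (h : Admissible m n ε) : (1 : ℝ) ≤ n := by exact_mod_cast h.n_pos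

lemma four_mul_le (h : Admissible m n ε) : 4 * (m * n) ≤ 2 * m * n ^ 2 / ε := by
  have hn := h.one_le_n; have hm := h.one_le_m
  rw [le_div_iff₀ h.ε_pos]
  have h1 := mul_le_mul_of_nonneg_left h.ε_le (show (0 : ℝ) ≤ 4 * (m * n) by positivity)
  linarith

lemma one_le_mul (h : Admissible m n ε) : (1 : ℝ) ≤ m * n :=
  one_le_mul_of_one_le_of_one_le h.one_le_m h.one_le_n

lemma one_le_log (h : Admissible m n ε) : 1 ≤ Real.log (2 * m * n ^ 2 / ε) := by
  rw [Real.le_log_iff_exp_le (by linarith [h.four_mul_le, h.one_le_mul])]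
  linarith [h.four_mul_le, h.one_le_mul, Real.exp_one_lt_d9]

lemma beta_pos (h : Admissible m n ε) : 0 < beta m n ε := by
  have := h.one_le_log; have := h.one_le_n; have := h.ε_pos
  unfold beta; positivity

lemma beta_le (h : Admissible m n ε) : beta m n ε ≤ ε / (6 * n) := by
  have h1 := h.one_le_log; have hn := h.one_le_n; have := h.ε_pos
  unfold beta
  refine div_le_div_of_nonneg_left this.le (by positivity) ?_
  exact le_mul_of_one_le_right (by positivity) h1

lemma ratio_le (h : Admissible m n ε) : ε / n ≤ 1 / 2 := by
  have hn := h.one_le_n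
  rw [div_le_iff₀ (by linarith)]
  linarith [h.ε_le]

lemma ratio_pos (h : Admissible m n ε) : 0 < ε / n := by
  have hn := h.one_le_n
  exact div_pos h.ε_pos (by linarith)

lemma one_lt_expo (h : Admissible m n ε) : 1 < expo m n ε := by
  have := h.beta_pos
  unfold expo
  rw [lt_div_iff₀ this]; linarith

lemma expo_eq (h : Admissible m n ε) : expo m n ε = 1 / beta m n ε + 1 := by
  have := h.beta_pos.ne'
  unfold expo; field_simp

lemma omega_pos (h : Admissible m n ε) : 0 < omega m n ε := by
  have h1 := h.ratio_le; have h2 := h.ratio_pos; have h3 := h.one_le_mul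
  refine Real.log_pos ?_
  rw [lt_div_iff₀ (by linarith)]; linarith

lemma omega_le (h : Admissible m n ε) : omega m n ε ≤ Real.log (2 * m * n) := by
  have h1 := h.ratio_le; have h2 := h.ratio_pos; have h3 := h.one_le_mul
  refine Real.log_le_log (by apply div_pos <;> linarith) ?_
  rw [div_le_iff₀ (by linarith)]; nlinarith

lemma log_two_le (h : Admissible m n ε) : 1 / 2 ≤ Real.log (2 * m * n) := by
  have h3 := h.one_le_mul
  have h4 : Real.log 2 ≤ Real.log (2 * m * n) := Real.log_le_log (by norm_num) (by linarith)
  linarith [Real.log_two_gt_d9]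

lemma le_bigL (_h : Admissible m n ε) : 4 * omega m n ε * expo m n ε ≤ bigL m n ε := by
  refine le_trans (le_of_eq ?_) (le_max_left _ _)
  unfold expo; ring

lemma le_three_bigL (_h : Admissible m n ε) :
    16 * n * Real.log (2 * m * n) / ε + 1 ≤ 3 * bigL m n ε := by
  have h1 : 16 * n * Real.log (2 * m * n) / (3 * ε) + 1 / 3 ≤ bigL m n ε := le_max_right _ _
  have h2 : 16 * n * Real.log (2 * m * n) / (3 * ε) = 16 * n * Real.log (2 * m * n) / ε / 3 := by
    rw [mul_comm (3 : ℝ), div_div]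
  linarith

lemma two_le_growth (h : Admissible m n ε) : 2 ≤ 4 * n * Real.log (2 * m * n) / ε := by
  have := h.ε_pos; have h1 := h.log_two_le; have h2 := h.one_le_n
  rw [le_div_iff₀ this]
  nlinarith [h.ε_le]

lemma nine_le_three_bigL (h : Admissible m n ε) : 9 ≤ 3 * bigL m n ε := by
  have h1 := h.two_le_growth; have h2 := h.le_three_bigL
  have : 16 * n * Real.log (2 * m * n) / ε = 4 * (4 * n * Real.log (2 * m * n) / ε) := by ring
  linarith

lemma tau_pos (h : Admissible m n ε) : 0 < tau m n ε := by
  have := h.nine_le_three_bigL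
  unfold tau; positivity

lemma three_bigL_mul_tau (h : Admissible m n ε) : 3 * bigL m n ε * tau m n ε = 1 := by
  have := h.nine_le_three_bigL
  unfold tau
  exact mul_one_div_cancel (by linarith)

lemma tau_lt_one (h : Admissible m n ε) : tau m n ε < 1 := by
  have h1 := h.nine_le_three_bigL
  have := h.three_bigL_mul_tau; have := h.tau_pos
  nlinarith

lemma eta_eq (h : Admissible m n ε) (k : ℕ) :
    eta m n ε k * (1 - tau m n ε) ^ k = tau m n ε := by
  have h1 : 1 - tau m n ε ≠ 0 := by linarith [h.tau_lt_one]
  induction k with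
  | zero => simp [eta, tau]
  | succ k ih =>
    calc _ = (1 / (1 - tau m n ε) * (1 - tau m n ε)) *
          (eta m n ε k * (1 - tau m n ε) ^ k) := by rw [eta, pow_succ]; ring
      _ = _ := by rw [ih, one_div_mul_cancel h1, one_mul]

lemma eta_succ (h : Admissible m n ε) (k : ℕ) :
    (1 - tau m n ε) * eta m n ε (k + 1) = eta m n ε k := by
  have h1 : 1 - tau m n ε ≠ 0 := by linarith [h.tau_lt_one]
  rw [eta]; field_simp

lemma eta_pos (h : Admissible m n ε) (k : ℕ) : 0 < eta m n ε k := by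
  have h1 := h.eta_eq k
  have h2 : 0 < (1 - tau m n ε) ^ k := pow_pos (by linarith [h.tau_lt_one]) k
  have h3 := h.tau_pos
  rw [← h1] at h3
  exact pos_of_mul_pos_left h3 h2.le

lemma log_inv_pos (h : Admissible m n ε) : 0 < Real.log (1 / (1 - tau m n ε)) := by
  have := h.tau_lt_one; have := h.tau_pos
  refine Real.log_pos ?_
  rw [lt_div_iff₀ (by linarith)]; linarith

lemma growth_le (h : Admissible m n ε) :
    4 * n * Real.log (2 * m * n) / ε ≤ 3 * bigL m n ε * eta m n ε (iterations m n ε) := by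
  have h1 := Nat.le_ceil (Real.log (4 * n * Real.log (2 * m * n) / ε) /
    Real.log (1 / (1 - tau m n ε)))
  change _ ≤ ((iterations m n ε : ℕ) : ℝ) at h1
  have hr : 0 < 1 - tau m n ε := by linarith [h.tau_lt_one]
  rw [div_le_iff₀ h.log_inv_pos, ← Real.log_pow,
    Real.log_le_log_iff (by linarith [h.two_le_growth]) (by positivity)] at h1
  refine h1.trans (le_of_eq ?_)
  have h2 := h.eta_eq (iterations m n ε)
  have h3 := h.three_bigL_mul_tau
  rw [← h2, ← mul_assoc] at h3
  rw [div_pow, one_pow, one_div]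
  exact (eq_inv_of_mul_eq_one_left h3).symm

/-- Before the last iteration the weight `3 L η_k` is still below the target `M = 4 n log(2mn) / ε`.
The second term in the maximum defining `L` gives `3L ≥ 4M + 1`, which leaves room for one more
factor `1 / (1 - τ)`. -/
lemma eta_le_one (h : Admissible m n ε) {k : ℕ} (hk : k < iterations m n ε) :
    eta m n ε (k + 1) ≤ 1 := by
  have h1 := Nat.lt_ceil.1 hk
  have hr : 0 < 1 - tau m n ε := by linarith [h.tau_lt_one]
  rw [lt_div_iff₀ h.log_inv_pos, ← Real.log_pow,
    Real.log_lt_log_iff (by positivity) (by linarith [h.two_le_growth])] at h1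
  rw [div_pow, one_pow, one_div, ← one_div, div_lt_iff₀ (by positivity)] at h1
  have h2 := h.eta_eq k
  have h3 := h.eta_succ k
  have h4 := h.le_three_bigL
  have h5 := h.three_bigL_mul_tau
  have h6 := h.tau_pos
  set M := 4 * n * Real.log (2 * m * n) / ε with hM
  have e : 16 * n * Real.log (2 * m * n) / ε = 4 * M := by rw [hM]; ring
  rw [e] at h4
  have hMp : 2 ≤ M := h.two_le_growth
  have h7 : M * tau m n ε ≤ 1 - tau m n ε := by nlinarith
  have h8 : eta m n ε k ≤ M * tau m n ε := by
    have := mul_le_mul_of_nonneg_left h1.le (h.eta_pos k).le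
    rw [mul_one, mul_left_comm, h2] at this
    exact this
  rw [← h3] at h8
  have h9 : (1 - tau m n ε) * eta m n ε (k + 1) ≤ (1 - tau m n ε) * 1 := by linarith
  exact le_of_mul_le_mul_left h9 hr

lemma mem_box_iff (x : Fin n → ℝ) :
    x ∈ box m n ε ↔ ∀ j, x j ∈ Set.Icc (-omega m n ε) 0 := by
  simp [box, Set.mem_Icc, Pi.le_def, forall_and]

lemma truncGrad_eq (h : Admissible m n ε) (A : Matrix (Fin m) (Fin n) ℝ) (x : Fin n → ℝ)
    (j : Fin n) : truncGrad A ε x j = min 1 (powGrad A (expo m n ε) x j) := by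
  unfold truncGrad gradReg
  rw [regObjective_eq, (hasDerivAt_powObjective h.one_lt_expo A x j).deriv]

end Admissible

variable {m n : ℕ} {ω η : ℝ}

/-- The projected step minimizes the mirror descent objective, with quadratic growth. -/
lemma sum_boxStep_quadratic_growth (hω : 0 < ω) (g z w : Fin n → ℝ)
    (hw : ∀ j, w j ∈ Set.Icc (-ω) 0) :
    1 / (2 * ω) * ∑ j, (boxStep ω η (g j) (z j) - z j) ^ 2 +
        ∑ j, η * g j * boxStep ω η (g j) (z j) +
        1 / (2 * ω) * ∑ j, (w j - boxStep ω η (g j) (z j)) ^ 2 ≤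
      1 / (2 * ω) * ∑ j, (w j - z j) ^ 2 + ∑ j, η * g j * w j := by
  simp_rw [Finset.mul_sum, ← Finset.sum_add_distrib]
  exact Finset.sum_le_sum fun j _ => boxStep_quadratic_growth hω (hw j)

/-- Quadratic growth forces any minimizer to have distance zero from the clipped point, so the
argmin is unique and an arbitrary run obeys the explicit update. -/
lemma eq_boxStep_of_isMinOn (hω : 0 < ω) {g z w : Fin n → ℝ}
    (hw : w ∈ Set.Icc (fun _ : Fin n => -ω) (fun _ => 0))
    (hmin : IsMinOn (fun w : Fin n → ℝ => 1 / (2 * ω) * ∑ j, (w j - z j) ^ 2 +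
      ∑ j, η * g j * w j) (Set.Icc (fun _ : Fin n => -ω) (fun _ => 0)) w) (j : Fin n) :
    w j = boxStep ω η (g j) (z j) := by
  have h1 := sum_boxStep_quadratic_growth (η := η) hω g z w fun j => ⟨hw.1 j, hw.2 j⟩
  have h2 := hmin (show (fun j => boxStep ω η (g j) (z j)) ∈
    Set.Icc (fun _ : Fin n => -ω) (fun _ => 0) from
      ⟨fun j => (boxStep_mem hω _ _ _).1, fun j => (boxStep_mem hω _ _ _).2⟩)
  simp only [Set.mem_ofPred_eq] at h2
  have h3 : 1 / (2 * ω) * ∑ j, (w j - boxStep ω η (g j) (z j)) ^ 2 ≤ 0 := by linarith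
  have h4 : ∑ j, (w j - boxStep ω η (g j) (z j)) ^ 2 ≤ 0 := by
    have : 0 < 1 / (2 * ω) := by positivity
    by_contra hcon
    have := mul_pos this (not_le.1 hcon)
    linarith
  have h5 := (Finset.sum_eq_zero_iff_of_nonneg fun j _ => sq_nonneg _).1
    (le_antisymm h4 (Finset.sum_nonneg fun j _ => sq_nonneg _)) j (Finset.mem_univ j)
  exact sub_eq_zero.1 (pow_eq_zero_iff (two_ne_zero)|>.1 h5)

/-! ### Invariants and the potential along a whole run. -/

variable {A : Matrix (Fin m) (Fin n) ℝ} {ε : ℝ} {x y z : ℕ → Fin n → ℝ}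

namespace IsRun

lemma z_mem (hrun : IsRun A ε x y z) (h : Admissible m n ε) {k : ℕ} (hk : k ≤ iterations m n ε)
    (j : Fin n) : z k j ∈ Set.Icc (-omega m n ε) 0 := by
  cases k with
  | zero => rw [hrun.z_zero]; exact ⟨le_rfl, by linarith [h.omega_pos]⟩
  | succ k => exact (Admissible.mem_box_iff _).1 (hrun.mirror_mem k hk) j

lemma isStep (hrun : IsRun A ε x y z) (h : Admissible m n ε) {k : ℕ} (hk : k < iterations m n ε) :
    IsStep A (expo m n ε) (omega m n ε) (bigL m n ε) (tau m n ε) (eta m n ε (k + 1)) (y k) (z k)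
      (x (k + 1)) (y (k + 1)) (z (k + 1)) where
  coupling := hrun.coupling k hk
  mirror j := by
    rw [← h.truncGrad_eq]
    exact eq_boxStep_of_isMinOn h.omega_pos (g := truncGrad A ε (x (k + 1)))
      (hrun.mirror_mem k hk) (hrun.mirror_min k hk) j
  descent := hrun.descent k hk

lemma y_nonpos (hrun : IsRun A ε x y z) (hA : Normalized A) (h : Admissible m n ε) (k : ℕ)
    (hk : k ≤ iterations m n ε) : ∀ j, y k j ≤ 0 := by
  induction k with
  | zero => intro j; rw [hrun.y_zero]; simpa using h.omega_pos.le
  | succ k ih =>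
    exact (hrun.isStep h hk).descent_nonpos hA h.one_lt_expo h.omega_pos (h.eta_pos _) h.le_bigL
      h.tau_pos.le h.tau_lt_one.le (hrun.z_mem h (Nat.le_of_succ_le hk))
      (ih (Nat.le_of_succ_le hk))

/-- The descent coefficient is `1 / (η_k L) = 3 (1 - τ)^k`. With the extra term proportional to `z_k
+ ω`, the old `z` contributions telescope in the induction, leaving `y` above the lower wall
although its individual descent steps are not clipped. -/
lemma le_y (hrun : IsRun A ε x y z) (h : Admissible m n ε) (k : ℕ)
    (hk : k ≤ iterations m n ε) (j : Fin n) :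
    -omega m n ε + 3 * (1 - tau m n ε) ^ k * (z k j + omega m n ε) ≤ y k j := by
  induction k with
  | zero => simp [hrun.y_zero, hrun.z_zero]
  | succ k ih =>
    have hy := congrFun (hrun.descent k hk) j
    rw [hrun.coupling k hk] at hy
    simp only [Pi.add_apply, Pi.smul_apply, Pi.sub_apply, smul_eq_mul] at hy
    have hstep : 1 / (eta m n ε (k + 1) * bigL m n ε) = 3 * (1 - tau m n ε) ^ (k + 1) := by
      have h1 := h.eta_eq (k + 1); have h2 := h.three_bigL_mul_tau
      have h3 := h.eta_pos (k + 1)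
      have h4 : 0 < bigL m n ε := by linarith [h.nine_le_three_bigL]
      rw [div_eq_iff (by positivity)]
      rw [← h1] at h2; linarith
    rw [hstep] at hy
    have ih := ih (Nat.le_of_succ_le hk)
    have hz := (hrun.z_mem h (Nat.le_of_succ_le hk) j).1
    have ht := h.tau_pos
    have hr : 0 ≤ 1 - tau m n ε := by linarith [h.tau_lt_one]
    have h5 := mul_le_mul_of_nonneg_left ih hr
    have h6 := mul_le_mul_of_nonneg_left hz ht.le
    rw [hy, pow_succ]
    linarith

lemma y_mem_box (hrun : IsRun A ε x y z) (hA : Normalized A) (h : Admissible m n ε) :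
    y (iterations m n ε) ∈ box m n ε := by
  refine (Admissible.mem_box_iff _).2 fun j => ⟨?_, hrun.y_nonpos hA h _ le_rfl j⟩
  have h1 := hrun.le_y h _ le_rfl j
  have h2 := (hrun.z_mem h (le_refl (iterations m n ε)) j).1
  have h3 : 0 ≤ 3 * (1 - tau m n ε) ^ iterations m n ε := by
    have : 0 ≤ 1 - tau m n ε := by linarith [h.tau_lt_one]
    positivity
  have h4 := mul_nonneg h3 (by linarith : 0 ≤ z (iterations m n ε) j + omega m n ε)
  linarith

lemma potential_le (hrun : IsRun A ε x y z) (hA : Normalized A) (h : Admissible m n ε)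
    {u : Fin n → ℝ} (hu : ∀ j, u j ∈ Set.Icc (-omega m n ε) 0) (k : ℕ)
    (hk : k ≤ iterations m n ε) :
    3 * bigL m n ε * eta m n ε k * (powObjective A (expo m n ε) (y k) -
        powObjective A (expo m n ε) u) + 1 / (2 * omega m n ε) * ∑ j, (z k j - u j) ^ 2 ≤
      powObjective A (expo m n ε) (y 0) - powObjective A (expo m n ε) u +
        1 / (2 * omega m n ε) * ∑ j, (z 0 j - u j) ^ 2 := by
  induction k with
  | zero =>
    have : 3 * bigL m n ε * eta m n ε 0 = 1 := h.three_bigL_mul_tau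
    rw [this, one_mul]
  | succ k ih =>
    refine le_trans ?_ (ih (Nat.le_of_succ_le hk))
    have := (hrun.isStep h hk).potential_le hA.1 h.one_lt_expo h.omega_pos (h.eta_pos _)
      (h.eta_le_one hk) h.le_bigL h.three_bigL_mul_tau h.tau_lt_one.le
      (hrun.z_mem h (Nat.le_of_succ_le hk)) hu
    rwa [h.eta_succ] at this

end IsRun

lemma Normalized.entry_le_one (hA : Normalized A) (i : Fin m) (j : Fin n) : A i j ≤ 1 :=
  (hA.2 j).2 ⟨i, rfl⟩

lemma powObjective_nonneg {p : ℝ} (hA : ∀ i j, 0 ≤ A i j) (hp : 0 < p) {u : Fin n → ℝ}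
    (hu : ∀ j, u j ≤ 0) : 0 ≤ powObjective A p u := by
  have h1 : ∑ j, u j ≤ 0 := Finset.sum_nonpos fun j _ => hu j
  have h2 : 0 ≤ ∑ i, (A *ᵥ expVec u) i ^ p :=
    Finset.sum_nonneg fun i _ => Real.rpow_nonneg (mulVec_expVec_nonneg hA u i) p
  have := mul_nonneg (inv_pos.2 hp).le h2
  unfold powObjective; linarith

/-- The value at the starting point. -/
lemma powObjective_start_le (hA : Normalized A) (h : Admissible m n ε) :
    powObjective A (expo m n ε) (fun _ => -omega m n ε) ≤ n * omega m n ε + 1 := by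
  have hp := h.one_lt_expo
  have h0 := h.ratio_le; have h1 := h.ratio_pos; have h2 := h.one_le_mul
  have hm := h.one_le_m; have hn := h.one_le_n
  have hq : ∀ i, (A *ᵥ expVec fun _ => -omega m n ε) i ≤ 1 / m := by
    intro i
    have hexp : Real.exp (-omega m n ε) ≤ 1 / (m * n) := by
      rw [omega, Real.exp_neg, Real.exp_log (by apply div_pos <;> linarith), inv_div]
      gcongr; linarith
    rw [mulVec_expVec]
    calc _ ≤ ∑ j : Fin n, (1 : ℝ) * (1 / (m * n)) := by
            refine Finset.sum_le_sum fun j _ => ?_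
            exact mul_le_mul (hA.entry_le_one i j) hexp (Real.exp_pos _).le zero_le_one
      _ = 1 / m := by simp; field_simp
  have hs : ∑ i, (A *ᵥ expVec fun _ => -omega m n ε) i ^ expo m n ε ≤ 1 := by
    calc _ ≤ ∑ i : Fin m, (1 / (m : ℝ)) := by
            refine Finset.sum_le_sum fun i _ => ?_
            have hnn := mulVec_expVec_nonneg hA.1 (fun _ => -omega m n ε) i
            refine le_trans ?_ (hq i)
            refine Real.rpow_le_self_of_le_one hnn ((hq i).trans ?_) hp.le
            exact (div_le_one (by linarith)).2 hm
      _ = 1 := by simp; field_simp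
  have h3 : (expo m n ε)⁻¹ ≤ 1 := inv_le_one_of_one_le₀ hp.le
  have h4 : 0 < (expo m n ε)⁻¹ := inv_pos.2 (by linarith)
  have h5 := mul_le_mul_of_nonneg_left hs h4.le
  unfold powObjective
  simp only [Finset.sum_const, Finset.card_univ, Fintype.card_fin, nsmul_eq_mul]
  linarith

/-- The last gradient descent iterate is an additive `ε`-minimizer over the box. -/
lemma IsRun.objective_le (hrun : IsRun A ε x y z) (hA : Normalized A) (h : Admissible m n ε)
    {u : Fin n → ℝ} (hu : u ∈ box m n ε) :
    powObjective A (expo m n ε) (y (iterations m n ε)) ≤ powObjective A (expo m n ε) u + ε := by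
  rw [Admissible.mem_box_iff] at hu
  have h1 := hrun.potential_le hA h hu _ le_rfl
  have hω := h.omega_pos
  have h2 : 0 ≤ 1 / (2 * omega m n ε) * ∑ j, (z (iterations m n ε) j - u j) ^ 2 := by positivity
  have h3 : 1 / (2 * omega m n ε) * ∑ j, (z 0 j - u j) ^ 2 ≤ n * omega m n ε / 2 := by
    have : ∑ j, (z 0 j - u j) ^ 2 ≤ ∑ j : Fin n, omega m n ε ^ 2 := by
      refine Finset.sum_le_sum fun j _ => ?_
      rw [hrun.z_zero]
      obtain ⟨h4, h5⟩ := hu j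
      nlinarith
    calc _ ≤ 1 / (2 * omega m n ε) * ∑ j : Fin n, omega m n ε ^ 2 := by gcongr
      _ = _ := by simp; field_simp
  have h4 := powObjective_start_le hA h
  rw [← hrun.y_zero] at h4
  have h5 := powObjective_nonneg hA.1 (by linarith [h.one_lt_expo] : 0 < expo m n ε)
    fun j => (hu j).2
  have h6 := h.omega_le; have h7 := h.log_two_le; have hn := h.one_le_n
  have h8 : n * omega m n ε ≤ n * Real.log (2 * m * n) := by gcongr
  -- This absorbs the constant `1` in the initial potential `3nω/2 + 1`, which is then at most `4 n
  -- log(2mn)`.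
  have h9 : 1 / 2 ≤ n * Real.log (2 * m * n) := by nlinarith
  have h10 := h.growth_le
  rw [div_le_iff₀ h.ε_pos] at h10
  by_contra hcon
  push Not at hcon
  set K := 3 * bigL m n ε * eta m n ε (iterations m n ε)
  set D := powObjective A (expo m n ε) (y (iterations m n ε)) - powObjective A (expo m n ε) u
  have hD : ε < D := by simp only [D]; linarith
  have hK : 0 < K := by
    have := h.eta_pos (iterations m n ε); have := h.nine_le_three_bigL
    simp only [K]; positivity
  have := mul_lt_mul_of_pos_left hD hK
  linarith

end FairPacking
end

noncomputable section
namespace FairPacking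

/-! ### Guarantees of the returned point and the iteration count -/

variable {m n : ℕ} {A : Matrix (Fin m) (Fin n) ℝ} {ε : ℝ} {x y z : ℕ → Fin n → ℝ}

namespace Admissible

lemma ratio_div_beta (h : Admissible m n ε) :
    ε / n / beta m n ε = 6 * Real.log (2 * m * n ^ 2 / ε) := by
  have := h.one_le_log; have := h.one_le_n; have := h.ε_pos
  unfold beta; field_simp

/-- With `X = 2mn²/ε`, both `p` and the value bound are controlled by `n`, `1/ε` and `log X`. The
power `4` is what the constant `6` in `β` pays for, as `(2/3) * 6 = 4`. -/
lemma expo_mul_start_le (h : Admissible m n ε) :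
    expo m n ε * (n * omega m n ε + 1 + ε) ≤ (2 * m * n ^ 2 / ε) ^ 4 := by
  have hΛ := h.one_le_log; have hn := h.one_le_n; have hm := h.one_le_m; have hε := h.ε_pos
  have hεn := h.ε_le
  have h4 := h.four_mul_le; have h1 := h.one_le_mul; have hω := h.omega_le
  set X := 2 * m * n ^ 2 / ε with hX
  have hX4 : 4 ≤ X := by linarith
  set Λ := Real.log X
  have hlog2 : Real.log 2 < 0.7 := by linarith [Real.log_two_lt_d9]
  have hlog2' : 0.6 < Real.log 2 := by linarith [Real.log_two_gt_d9]
  have hΛX : Λ ≤ X / 2 := by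
    have h2 := Real.log_le_sub_one_of_pos (show 0 < X / 2 by linarith)
    rw [Real.log_div (by linarith) (by norm_num)] at h2
    linarith
  have hωΛ : omega m n ε ≤ Λ - Real.log 2 := by
    rw [← Real.log_div (by linarith) (by norm_num)]
    exact hω.trans (Real.log_le_log (by linarith) (by linarith))
  have h5 : n * omega m n ε + 1 + ε ≤ 2 * (n * Λ) := by
    have h6 : n * omega m n ε ≤ n * (Λ - Real.log 2) := by gcongr
    have h7 : n * Λ ≥ 1 := one_le_mul_of_one_le_of_one_le hn hΛ
    nlinarith
  have h8 : expo m n ε ≤ 7 * (n * Λ) / ε := by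
    rw [h.expo_eq, beta, one_div_div, le_div_iff₀ hε, add_mul, div_mul_cancel₀ _ hε.ne']
    have : ε ≤ n * Λ := by nlinarith
    linarith
  have h9 : (n : ℝ) ^ 2 / ε ≤ X / 2 := by
    rw [hX, div_div, div_le_div_iff₀ hε (by positivity)]
    have : (n : ℝ) ^ 2 ≤ m * n ^ 2 := le_mul_of_one_le_left (by positivity) hm
    nlinarith
  have hp := h.one_lt_expo
  calc _ ≤ (7 * (n * Λ) / ε) * (2 * (n * Λ)) := by
          refine mul_le_mul h8 h5 ?_ (by positivity)
          have := h.omega_pos; positivity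
    _ = 14 * (n ^ 2 / ε) * Λ ^ 2 := by ring
    _ ≤ 14 * (X / 2) * (X / 2) ^ 2 := by gcongr
    _ ≤ X ^ 4 := by
          have : 0 ≤ X ^ 3 * (X - 4) := mul_nonneg (by positivity) (by linarith)
          nlinarith [pow_pos (by linarith : 0 < X) 3]

/-- A coordinate whose regularizer is at most the initial value is almost feasible. -/
lemma le_one_add_of_rpow_le (h : Admissible m n ε) {q : ℝ}
    (hq : q ^ expo m n ε ≤ expo m n ε * (n * omega m n ε + 1 + ε)) : q ≤ 1 + ε / n := by
  have ht0 := h.ratio_pos; have ht1 := h.ratio_le; have hβ := h.beta_pos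
  have hp := h.one_lt_expo
  set t := ε / n with ht
  by_contra hcon
  push Not at hcon
  have hX : 0 < 2 * m * n ^ 2 / ε := by linarith [h.four_mul_le, h.one_le_mul]
  -- The factor `2/3` leaves room for the quadratic term of `exp` when `t ≤ 1/2`.
  have h1 : Real.exp (2 * t / 3) ≤ 1 + t := by
    have := (abs_le.1 (Real.abs_exp_sub_one_sub_id_le (x := 2 * t / 3)
      (by rw [abs_of_pos (by linarith)]; linarith))).2
    nlinarith
  have h2 : (2 * m * n ^ 2 / ε) ^ 4 ≤ Real.exp (2 * t / 3) ^ expo m n ε := by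
    rw [← Real.exp_mul]
    have e : (2 * m * n ^ 2 / ε) ^ 4 = Real.exp (4 * Real.log (2 * m * n ^ 2 / ε)) := by
      rw [show 4 * Real.log (2 * m * n ^ 2 / ε) = ((4 : ℕ) : ℝ) * Real.log (2 * m * n ^ 2 / ε) by
        norm_num, Real.exp_nat_mul, Real.exp_log hX]
    rw [e]
    refine Real.exp_le_exp.2 ?_
    have h3 := h.ratio_div_beta
    rw [← ht] at h3
    have h5 : 2 * t / 3 * expo m n ε = 2 / 3 * (t / beta m n ε) + 2 * t / 3 := by
      rw [h.expo_eq]; ring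
    rw [h5, h3]; linarith
  have h6 : Real.exp (2 * t / 3) ^ expo m n ε < q ^ expo m n ε :=
    Real.rpow_lt_rpow (Real.exp_pos _).le (by linarith) (by linarith)
  linarith [h.expo_mul_start_le]

lemma const_mem_box (h : Admissible m n ε) : (fun _ : Fin n => -omega m n ε) ∈ box m n ε :=
  (mem_box_iff _).2 fun _ => ⟨le_rfl, by linarith [h.omega_pos]⟩

end Admissible

lemma IsRun.returned_mem_feasible (hrun : IsRun A ε x y z) (hA : Normalized A)
    (h : Admissible m n ε) : returned ε (y (iterations m n ε)) ∈ feasible A := by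
  have ht0 := h.ratio_pos
  set Y := y (iterations m n ε) with hY
  have hp := h.one_lt_expo
  refine ⟨fun j => (div_pos (Real.exp_pos _) (by linarith)).le, fun i => ?_⟩
  have e : (A *ᵥ returned ε Y) i = (A *ᵥ expVec Y) i / (1 + ε / n) := by
    simp only [Matrix.mulVec, dotProduct, returned, expVec, Finset.sum_div, mul_div_assoc]
  rw [e, div_le_one (by linarith)]
  refine h.le_one_add_of_rpow_le ?_
  have h1 := hrun.objective_le hA h h.const_mem_box
  have h2 := powObjective_start_le hA h
  have h3 : ∑ j, Y j ≤ 0 := Finset.sum_nonpos fun j _ => hrun.y_nonpos hA h _ le_rfl j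
  have h4 := Finset.single_le_sum (f := fun i : Fin m => (A *ᵥ expVec Y) i ^ expo m n ε)
    (fun k _ => Real.rpow_nonneg (mulVec_expVec_nonneg hA.1 Y k) _) (Finset.mem_univ i)
  -- The linear part `-∑ Y_j` is nonnegative, so the value bound controls the penalty alone.
  have h5 : (expo m n ε)⁻¹ * ∑ i, (A *ᵥ expVec Y) i ^ expo m n ε ≤
      n * omega m n ε + 1 + ε := by
    rw [← hY] at h1
    unfold powObjective at h1 h2; linarith
  rw [inv_mul_le_iff₀ (by linarith)] at h5
  exact h4.trans h5

/-! ### The fair packing problem -/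

lemma fairObjective_of_pos {v : Fin n → ℝ} (hv : ∀ j, 0 < v j) :
    fairObjective v = ((∑ j, Real.log (v j) : ℝ) : EReal) := by
  unfold fairObjective; exact if_pos hv

lemma fairObjective_of_not_pos {v : Fin n → ℝ} (hv : ¬ ∀ j, 0 < v j) :
    fairObjective v = ⊥ := by
  unfold fairObjective; exact if_neg hv

lemma Normalized.le_one_of_feasible (hA : Normalized A) {v : Fin n → ℝ} (hv : v ∈ feasible A)
    (j : Fin n) : v j ≤ 1 := by
  obtain ⟨i, hi⟩ := (hA.2 j).1
  have hi : A i j = 1 := hi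
  have h1 := Finset.single_le_sum (f := fun j => A i j * v j)
    (fun k _ => mul_nonneg (hA.1 i k) (hv.1 k)) (Finset.mem_univ j)
  simp only [hi, one_mul] at h1
  exact h1.trans (hv.2 i)

lemma Normalized.const_mem_feasible (hA : Normalized A) (hn : 1 ≤ n) :
    (fun _ : Fin n => 1 / (n : ℝ)) ∈ feasible A := by
  have hn' : (0 : ℝ) < n := by exact_mod_cast hn
  refine ⟨fun j => by positivity, fun i => ?_⟩
  calc (A *ᵥ fun _ : Fin n => 1 / (n : ℝ)) i = ∑ j, A i j * (1 / (n : ℝ)) := rfl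
    _ ≤ ∑ _j : Fin n, 1 * (1 / (n : ℝ)) := by
        refine Finset.sum_le_sum fun j _ => ?_
        exact mul_le_mul_of_nonneg_right (hA.entry_le_one i j) (by positivity)
    _ = 1 := by simp; field_simp

lemma Normalized.single_mem_feasible (hA : Normalized A) (j : Fin n) :
    Pi.single j 1 ∈ feasible A := by
  refine ⟨fun k => ?_, fun i => ?_⟩
  · by_cases h : k = j
    · subst h; simp
    · simp [h]
  · simpa [Matrix.mulVec_single] using hA.entry_le_one i j

lemma convex_feasible (A : Matrix (Fin m) (Fin n) ℝ) : Convex ℝ (feasible A) := by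
  intro v hv w hw a b ha hb hab
  refine ⟨fun j => ?_, fun i => ?_⟩
  · have h1 := mul_nonneg ha (hv.1 j)
    have h2 := mul_nonneg hb (hw.1 j)
    simp only [Pi.add_apply, Pi.smul_apply, smul_eq_mul]; linarith
  · rw [Matrix.mulVec_add, Matrix.mulVec_smul, Matrix.mulVec_smul]
    have h1 := mul_le_mul_of_nonneg_left (hv.2 i) ha
    have h2 := mul_le_mul_of_nonneg_left (hw.2 i) hb
    simp only [Pi.add_apply, Pi.smul_apply, smul_eq_mul]; linarith

lemma Normalized.isCompact_feasible (hA : Normalized A) : IsCompact (feasible A) := by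
  refine (isCompact_Icc (a := (fun _ => 0 : Fin n → ℝ)) (b := fun _ => 1)).of_isClosed_subset ?_
    fun v hv => ⟨hv.1, hA.le_one_of_feasible hv⟩
  have : feasible A = (⋂ j, {v | 0 ≤ v j}) ∩ ⋂ i, {v | (A *ᵥ v) i ≤ 1} := by
    ext v; simp [feasible]
  rw [this]
  refine (isClosed_iInter fun j => isClosed_le continuous_const (continuous_apply j)).inter
    (isClosed_iInter fun i => isClosed_le ?_ continuous_const)
  exact (continuous_apply i).comp (Continuous.matrix_mulVec continuous_const continuous_id)

lemma Normalized.exists_isFairSolution (hA : Normalized A) (hn : 1 ≤ n) :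
    ∃ v, IsFairSolution A v := by
  have hn' : (0 : ℝ) < n := by exact_mod_cast hn
  -- Maximizing the product is equivalent on positive points and is continuous on all of the compact
  -- feasible set, also where the objective is `⊥`.
  obtain ⟨v, hv, hmax⟩ := hA.isCompact_feasible.exists_isMaxOn
    ⟨_, hA.const_mem_feasible hn⟩ (f := fun v : Fin n → ℝ => ∏ j, v j)
    (continuous_finsetProd _ fun j _ => continuous_apply j).continuousOn
  have hprod : 0 < ∏ j, v j := by
    refine lt_of_lt_of_le ?_ (hmax (hA.const_mem_feasible hn))
    exact Finset.prod_pos fun j _ => by positivity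
  have hpos : ∀ j, 0 < v j := fun j => (hv.1 j).lt_of_ne' fun h0 =>
    hprod.ne' (Finset.prod_eq_zero (Finset.mem_univ j) h0)
  refine ⟨v, hv, fun w hw => ?_⟩
  change fairObjective w ≤ fairObjective v
  by_cases hwpos : ∀ j, 0 < w j
  · rw [fairObjective_of_pos hpos, fairObjective_of_pos hwpos, EReal.coe_le_coe_iff,
      ← Real.log_prod fun j _ => (hpos j).ne', ← Real.log_prod fun j _ => (hwpos j).ne']
    exact Real.log_le_log (Finset.prod_pos fun j _ => hwpos j) (hmax hw)
  · rw [fairObjective_of_not_pos hwpos]; exact bot_le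

lemma IsFairSolution.pos (hA : Normalized A) (hn : 1 ≤ n) {v : Fin n → ℝ}
    (hv : IsFairSolution A v) (j : Fin n) : 0 < v j := by
  have hn' : (0 : ℝ) < n := by exact_mod_cast hn
  by_contra hcon
  have h1 : fairObjective (fun _ : Fin n => 1 / (n : ℝ)) ≤ fairObjective v :=
    hv.2 (hA.const_mem_feasible hn)
  rw [fairObjective_of_not_pos (v := v) fun h => hcon (h j),
    fairObjective_of_pos fun _ => by positivity] at h1
  exact EReal.coe_ne_bot _ (le_bot_iff.1 h1)

/-- Each coordinate of a proportionally fair point is at least `1 / n`. -/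
lemma IsFairSolution.one_le_mul (hA : Normalized A) (hn : 1 ≤ n) {v : Fin n → ℝ}
    (hv : IsFairSolution A v) (j : Fin n) : 1 ≤ n * v j := by
  have hpos := hv.pos hA hn
  have hvj := hpos j
  have hn1 : (1 : ℝ) ≤ n := by exact_mod_cast hn
  have key : ∀ s : ℝ, 0 < s → s < 1 →
      (1 - (n - 1) * s) * ((1 - s) * v j + s) ≤ v j := by
    intro s hs0 hs1
    -- Move towards the unit vector `e_j`, feasible because entries are at most `1`, and compare
    -- products; Bernoulli bounds the loss in the other `n - 1` coordinates.
    set w := (1 - s) • v + s • Pi.single j 1 with hw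
    have hwf : w ∈ feasible A := convex_feasible A hv.1 (hA.single_mem_feasible j)
      (by linarith) hs0.le (by ring)
    have hwj : w j = (1 - s) * v j + s := by simp [hw]
    have hwk : ∀ k ≠ j, w k = (1 - s) * v k := fun k hk => by simp [hw, hk]
    have hwpos : ∀ k, 0 < w k := fun k => by
      by_cases hk : k = j
      · subst hk; rw [hwj]
        have := mul_pos (by linarith : 0 < 1 - s) hvj
        linarith
      · rw [hwk k hk]; exact mul_pos (by linarith) (hpos k)
    have h1 : fairObjective w ≤ fairObjective v := hv.2 hwf
    rw [fairObjective_of_pos hpos, fairObjective_of_pos hwpos, EReal.coe_le_coe_iff,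
      ← Real.log_prod fun j _ => (hpos j).ne', ← Real.log_prod fun j _ => (hwpos j).ne',
      Real.log_le_log_iff (Finset.prod_pos fun j _ => hwpos j)
        (Finset.prod_pos fun j _ => hpos j),
      ← Finset.mul_prod_erase _ _ (Finset.mem_univ j),
      ← Finset.mul_prod_erase _ _ (Finset.mem_univ j)] at h1
    have h2 : ∏ k ∈ Finset.univ.erase j, w k =
        (1 - s) ^ (n - 1) * ∏ k ∈ Finset.univ.erase j, v k := by
      rw [Finset.prod_congr rfl fun k hk => hwk k (Finset.ne_of_mem_erase hk),
        Finset.prod_mul_distrib, Finset.prod_const, Finset.card_erase_of_mem (Finset.mem_univ j)]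
      simp
    have hP : 0 < ∏ k ∈ Finset.univ.erase j, v k := Finset.prod_pos fun k _ => hpos k
    rw [h2, ← mul_assoc] at h1
    have h3 := le_of_mul_le_mul_right h1 hP
    have h4 := one_add_mul_le_pow (a := -s) (by linarith) (n - 1)
    rw [Nat.cast_sub hn, Nat.cast_one] at h4
    refine le_trans ?_ h3
    rw [mul_comm, ← hwj]
    refine mul_le_mul_of_nonneg_left ?_ (hwpos j).le
    rw [show 1 - s = 1 + -s by ring]
    linarith
  have hv1 := hA.le_one_of_feasible hv.1 j
  by_contra hcon
  push Not at hcon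
  set d := 1 - n * v j with hd
  have hd0 : 0 < d := by linarith
  -- The gain of the perturbation is `s d` to first order and the loss is at most `(n - 1) s²`, so
  -- `s = d / (2n)` contradicts optimality.
  have hs0 : 0 < d / (2 * n) := by positivity
  have hs1 : d / (2 * n) < 1 := by
    rw [div_lt_one (by positivity)]
    have : 0 < n * v j := by positivity
    linarith
  have h5 := key _ hs0 hs1
  set s := d / (2 * n)
  have h6 : s * (2 * n) = d := div_mul_cancel₀ _ (by positivity)
  have h7 : 0 ≤ s * (d - (n - 1) * s * (1 - v j)) - s * (d - (n - 1) * s) := by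
    have : s * (d - (n - 1) * s * (1 - v j)) - s * (d - (n - 1) * s) =
      s * s * (n - 1) * v j := by ring
    rw [this]
    exact mul_nonneg (mul_nonneg (by positivity) (by linarith)) hvj.le
  have h8 : s * (d - (n - 1) * s * (1 - v j)) ≤ 0 := by
    rw [hd]; linarith
  have h9 : 0 < s * (d - (n - 1) * s) := mul_pos hs0 (by nlinarith)
  linarith

lemma exists_isRegMinimizer (A : Matrix (Fin m) (Fin n) ℝ) (h : Admissible m n ε) :
    ∃ u, IsRegMinimizer A ε u := by
  have hp := h.one_lt_expo
  have hc : Continuous (regObjective A ε) := by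
    rw [regObjective_eq]
    unfold powObjective
    refine (continuous_finsetSum _ fun j _ => continuous_apply j).neg.add
      (continuous_const.mul (continuous_finsetSum _ fun i _ => ?_))
    refine Continuous.rpow_const ?_ fun _ => Or.inr (by linarith)
    simp only [mulVec_expVec]
    fun_prop
  obtain ⟨u, hu, hmin⟩ := (isCompact_Icc : IsCompact (box m n ε)).exists_isMinOn
    ⟨_, h.const_mem_box⟩ hc.continuousOn
  exact ⟨u, hu, hmin⟩

/-- A scaled fair solution has a small regularized value. -/
lemma IsFairSolution.exists_mem_box (hA : Normalized A) (h : Admissible m n ε) {v : Fin n → ℝ}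
    (hv : IsFairSolution A v) :
    ∃ u ∈ box m n ε, powObjective A (expo m n ε) u ≤ -∑ j, Real.log (v j) + 3 * ε := by
  have hpos := hv.pos hA h.n_pos
  have ht0 := h.ratio_pos; have ht1 := h.ratio_le; have hm := h.one_le_m; have hn := h.one_le_n
  have hp := h.one_lt_expo; have hβ := h.beta_pos
  have hnt : n * (ε / n) = ε := mul_div_cancel₀ _ (by linarith)
  set t := ε / n with ht
  have hr : 0 < 1 - t := by linarith
  refine ⟨fun j => Real.log ((1 - t) * v j), (Admissible.mem_box_iff _).2 fun j => ⟨?_, ?_⟩, ?_⟩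
  · rw [omega, ← Real.log_inv, inv_div, ← ht]
    refine Real.log_le_log (by have := h.one_le_mul; positivity) ?_
    rw [div_eq_mul_inv]
    refine mul_le_mul_of_nonneg_left ?_ hr.le
    rw [inv_le_iff_one_le_mul₀ (by linarith [h.one_le_mul])]
    have h1 := hv.one_le_mul hA h.n_pos j
    have := mul_le_mul hm h1 zero_le_one (by linarith)
    linarith
  · refine Real.log_nonpos (mul_nonneg hr.le (hpos j).le) ?_
    have := hA.le_one_of_feasible hv.1 j
    nlinarith [hpos j]
  · have hq : ∀ i, (A *ᵥ expVec fun j => Real.log ((1 - t) * v j)) i ≤ 1 - t := by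
      intro i
      have e : (expVec fun j => Real.log ((1 - t) * v j)) = (1 - t) • v := by
        funext j; simp [expVec, Real.exp_log (mul_pos hr (hpos j))]
      rw [e, Matrix.mulVec_smul]
      have := mul_le_mul_of_nonneg_left (hv.1.2 i) hr.le
      simpa using this
    have hX : 0 < 2 * m * n ^ 2 / ε := by linarith [h.four_mul_le, h.one_le_mul]
    -- Shrinking by `1 - t` makes each row's penalty at most `exp (-t p) ≤ ε / (2mn²)`; the bound
    -- `1/m` suffices to sum over rows.
    have hpow : (1 - t) ^ expo m n ε ≤ 1 / m := by
      calc (1 - t) ^ expo m n ε ≤ Real.exp (-t) ^ expo m n ε := by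
            refine Real.rpow_le_rpow hr.le ?_ (by linarith)
            linarith [Real.add_one_le_exp (-t)]
        _ = Real.exp (-t * expo m n ε) := (Real.exp_mul _ _).symm
        _ ≤ Real.exp (-Real.log (2 * m * n ^ 2 / ε)) := by
            refine Real.exp_le_exp.2 ?_
            have h1 := h.ratio_div_beta
            rw [← ht] at h1
            have : t * expo m n ε = t / beta m n ε + t := by rw [h.expo_eq]; ring
            linarith [h.one_le_log]
        _ = 1 / (2 * m * n ^ 2 / ε) := by rw [Real.exp_neg, Real.exp_log hX, one_div]
        _ ≤ 1 / m := by
            refine one_div_le_one_div_of_le (by linarith) ?_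
            refine le_trans ?_ h.four_mul_le
            nlinarith
    have hsum : ∑ i, (A *ᵥ expVec fun j => Real.log ((1 - t) * v j)) i ^ expo m n ε ≤ 1 := by
      calc _ ≤ ∑ _i : Fin m, (1 / (m : ℝ)) := by
            refine Finset.sum_le_sum fun i _ => ?_
            exact (Real.rpow_le_rpow (mulVec_expVec_nonneg hA.1 _ i) (hq i)
              (by linarith)).trans hpow
        _ = 1 := by simp; field_simp
    have hinv : (expo m n ε)⁻¹ ≤ ε := by
      have h1 : (expo m n ε)⁻¹ ≤ beta m n ε := by
        rw [expo, inv_div]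
        exact div_le_self hβ.le (by linarith)
      have h2 : ε / (6 * n) ≤ ε := div_le_self h.ε_pos.le (by linarith)
      linarith [h.beta_le]
    have hlog : -(2 * t) ≤ Real.log (1 - t) := by
      have h1 := Real.one_sub_inv_le_log_of_pos hr
      have h2 : (1 - t)⁻¹ ≤ 1 + 2 * t := by
        rw [inv_le_iff_one_le_mul₀ hr]; nlinarith
      linarith
    have hsl : ∑ j, Real.log ((1 - t) * v j) = n * Real.log (1 - t) + ∑ j, Real.log (v j) := by
      simp [Real.log_mul hr.ne' (hpos _).ne', Finset.sum_add_distrib]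
    have hnl := mul_le_mul_of_nonneg_left hlog (by linarith : (0 : ℝ) ≤ n)
    have h3 := mul_le_mul_of_nonneg_left hsum (inv_pos.2 (by linarith : 0 < expo m n ε)).le
    unfold powObjective
    rw [hsl]
    nlinarith

lemma IsRun.fairObjective_sub_le (hrun : IsRun A ε x y z) (hA : Normalized A)
    (h : Admissible m n ε) {v : Fin n → ℝ} (hv : IsFairSolution A v) :
    fairObjective v - fairObjective (returned ε (y (iterations m n ε))) ≤
      ((5 * ε : ℝ) : EReal) := by
  have ht0 := h.ratio_pos
  have hn := h.one_le_n
  have hnt : n * (ε / n) = ε := mul_div_cancel₀ _ (by linarith)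
  set Y := y (iterations m n ε) with hY
  have hret : ∀ j, 0 < returned ε Y j := fun j => by unfold returned; positivity
  rw [fairObjective_of_pos (hv.pos hA h.n_pos), fairObjective_of_pos hret, ← EReal.coe_sub,
    EReal.coe_le_coe_iff]
  obtain ⟨u, hu, hle⟩ := hv.exists_mem_box hA h
  have h1 := hrun.objective_le hA h hu
  rw [← hY] at h1
  have h2 : -∑ j, Y j ≤ powObjective A (expo m n ε) Y := by
    have h3 : 0 ≤ ∑ i, (A *ᵥ expVec Y) i ^ expo m n ε :=
      Finset.sum_nonneg fun i _ => Real.rpow_nonneg (mulVec_expVec_nonneg hA.1 Y i) _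
    have := mul_nonneg (inv_pos.2 (by linarith [h.one_lt_expo] : 0 < expo m n ε)).le h3
    unfold powObjective; linarith
  have h4 : ∑ j, Real.log (returned ε Y j) = ∑ j, Y j - n * Real.log (1 + ε / n) := by
    have h5 : ∀ j, Real.log (returned ε Y j) = Y j - Real.log (1 + ε / n) := fun j => by
      rw [returned, Real.log_div (Real.exp_pos _).ne' (by linarith), Real.log_exp]
    simp [h5]
  have h6 : n * Real.log (1 + ε / n) ≤ ε := by
    have := Real.log_le_sub_one_of_pos (by linarith : 0 < 1 + ε / n)
    have := mul_le_mul_of_nonneg_left this (by linarith : (0 : ℝ) ≤ n)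
    linarith
  linarith

/-! ### The iteration count -/

/-- With `ℓ = log S` and `r = n/ε`: `p = O(ℓ r)` and `ω = O(ℓ)` give `L ≤ 372 ℓ² r`. Since `log (1 /
(1 - τ)) ≥ τ = 1 / (3L)`, the count is at most `6ℓ * 3L + 1`, and `6 * 3 * 372 + 1 = 6697`. -/
lemma Admissible.iterations_le (h : Admissible m n ε) :
    (iterations m n ε : ℝ) ≤ 6697 * ((n : ℝ) / ε) * Real.log (2 + m + n + 1 / ε) ^ 3 := by
  have hm := h.one_le_m; have hn := h.one_le_n; have hε := h.ε_pos; have hεn := h.ε_le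
  have hmn := h.one_le_mul
  have hε' : 0 < 1 / ε := by positivity
  set S := 2 + m + n + 1 / ε with hS
  have hS4 : 4 ≤ S := by linarith
  have hmS : (m : ℝ) ≤ S := by linarith
  have hnS : (n : ℝ) ≤ S := by linarith
  have hεS : 1 / ε ≤ S := by linarith
  have hpow : ∀ (c : ℝ) (k : ℕ), 0 < c → c ≤ S ^ k → Real.log c ≤ k * Real.log S :=
    fun c k h0 h1 => by rw [← Real.log_pow]; exact Real.log_le_log h0 h1
  have hℓ : 1 ≤ Real.log S := by
    rw [Real.le_log_iff_exp_le (by linarith)]; linarith [Real.exp_one_lt_d9]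
  have hΛ : Real.log (2 * m * n ^ 2 / ε) ≤ 5 * Real.log S := by
    refine hpow _ 5 (by linarith [h.four_mul_le]) ?_
    calc 2 * m * n ^ 2 / ε = 2 * m * n ^ 2 * (1 / ε) := by ring
      _ ≤ S * S * S ^ 2 * S := by gcongr; linarith
      _ = S ^ 5 := by ring
  have hl2 : Real.log (2 * m * n) ≤ 3 * Real.log S := by
    refine hpow _ 3 (by linarith) ?_
    calc 2 * (m : ℝ) * n ≤ S * S * S := by gcongr; linarith
      _ = S ^ 3 := by ring
  have hG0 := h.two_le_growth
  have hG : Real.log (4 * n * Real.log (2 * m * n) / ε) ≤ 6 * Real.log S := by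
    refine hpow _ 6 (by linarith) ?_
    have h1 : Real.log (2 * m * n) ≤ 2 * m * n := by
      have := Real.log_le_sub_one_of_pos (show (0 : ℝ) < 2 * m * n by linarith)
      linarith
    calc 4 * n * Real.log (2 * m * n) / ε ≤ 4 * n * (2 * m * n) / ε := by gcongr
      _ = 4 * 2 * n * m * n * (1 / ε) := by ring
      _ ≤ S * S * S * S * S * S := by gcongr; linarith
      _ = S ^ 6 := by ring
  set ℓ := Real.log S
  set r := (n : ℝ) / ε with hr
  have hr2 : 2 ≤ r := by rw [hr, le_div_iff₀ hε]; linarith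
  have hp : expo m n ε ≤ 31 * (ℓ * r) := by
    rw [h.expo_eq, beta, one_div_div]
    have e : 6 * n * Real.log (2 * m * n ^ 2 / ε) / ε =
      6 * r * Real.log (2 * m * n ^ 2 / ε) := by rw [hr]; ring
    rw [e]
    have h1 : 6 * r * Real.log (2 * m * n ^ 2 / ε) ≤ 6 * r * (5 * ℓ) := by gcongr
    have h2 : 1 ≤ ℓ * r := by nlinarith
    linarith
  have hL : bigL m n ε ≤ 372 * (ℓ ^ 2 * r) := by
    refine max_le ?_ ?_
    · have e : 4 * omega m n ε * (1 + beta m n ε) / beta m n ε =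
        4 * omega m n ε * expo m n ε := by unfold expo; ring
      rw [e]
      have h1 := h.omega_le.trans hl2
      have h2 := h.omega_pos
      have h3 := h.one_lt_expo
      calc _ ≤ 4 * (3 * ℓ) * (31 * (ℓ * r)) := by gcongr
        _ = _ := by ring
    · have e : 16 * n * Real.log (2 * m * n) / (3 * ε) =
        16 / 3 * r * Real.log (2 * m * n) := by rw [hr]; field_simp
      rw [e]
      have h1 : 16 / 3 * r * Real.log (2 * m * n) ≤ 16 / 3 * r * (3 * ℓ) := by gcongr
      have h2 : 1 ≤ ℓ * r := by nlinarith
      have h3 : ℓ * r ≤ ℓ ^ 2 * r := by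
        have := mul_le_mul_of_nonneg_right hℓ (by positivity : 0 ≤ ℓ * r)
        linarith
      linarith
  have hτ : tau m n ε ≤ Real.log (1 / (1 - tau m n ε)) := by
    rw [one_div, Real.log_inv]
    have := Real.log_le_sub_one_of_pos (show 0 < 1 - tau m n ε by linarith [h.tau_lt_one])
    linarith
  have hτ0 := h.tau_pos
  have hratio : Real.log (4 * n * Real.log (2 * m * n) / ε) / Real.log (1 / (1 - tau m n ε)) ≤
      6 * ℓ * (3 * bigL m n ε) := by
    rw [div_le_iff₀ h.log_inv_pos]
    have h3 := h.nine_le_three_bigL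
    have h1 : 6 * ℓ * (3 * bigL m n ε) * tau m n ε ≤
        6 * ℓ * (3 * bigL m n ε) * Real.log (1 / (1 - tau m n ε)) := by gcongr
    have h2 := h.three_bigL_mul_tau
    rw [mul_assoc (6 * ℓ), h2, mul_one] at h1
    linarith
  have hceil := (Nat.ceil_lt_add_one (R := ℝ)
    (div_nonneg (Real.log_nonneg (by linarith : 1 ≤ 4 * n * Real.log (2 * m * n) / ε))
      h.log_inv_pos.le)).le
  change ((iterations m n ε : ℕ) : ℝ) ≤ _ at hceil
  have h4 : 6 * ℓ * (3 * bigL m n ε) ≤ 6 * ℓ * (3 * (372 * (ℓ ^ 2 * r))) := by gcongr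
  have h5 : 1 ≤ r * ℓ ^ 3 := by
    have : 1 ≤ ℓ ^ 3 := one_le_pow₀ hℓ
    nlinarith
  nlinarith

end FairPacking
end

noncomputable section
namespace FairPacking

/-! ### The distributed protocol -/

namespace LocalExpr

/-- `β` in terms of `m`, `n`, `ε`. -/
def betaExpr : LocalExpr (Fin 3) :=
  div (var 2) (mul (mul (const 6) (var 1))
    (log (div (mul (mul (const 2) (var 0)) (mul (var 1) (var 1))) (var 2))))

/-- `ω` in terms of `m`, `n`, `ε`. -/
def omegaExpr : LocalExpr (Fin 3) :=
  log (div (mul (var 0) (var 1)) (sub (const 1) (div (var 2) (var 1))))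

/-- `log (2 m n)`. -/
def logExpr : LocalExpr (Fin 3) := log (mul (mul (const 2) (var 0)) (var 1))

/-- `L` in terms of `m`, `n`, `ε`. -/
def bigLExpr : LocalExpr (Fin 3) :=
  max (div (mul (mul (const 4) omegaExpr) (add (const 1) betaExpr)) betaExpr)
    (add (div (mul (mul (const 16) (var 1)) logExpr) (mul (const 3) (var 2)))
      (div (const 1) (const 3)))

/-- `τ` in terms of `m`, `n`, `ε`. -/
def tauExpr : LocalExpr (Fin 3) := div (const 1) (mul (const 3) bigLExpr)

/-- The number of iterations before rounding. -/
def iterationsExpr : LocalExpr (Fin 3) :=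
  div (log (div (mul (mul (const 4) (var 1)) logExpr) (var 2)))
    (log (div (const 1) (sub (const 1) tauExpr)))

variable (m n : ℕ) (ε : ℝ)

@[simp] lemma eval_betaExpr : betaExpr.eval ![(m : ℝ), (n : ℝ), ε] = beta m n ε := by
  simp [betaExpr, eval, beta, pow_two]

@[simp] lemma eval_omegaExpr : omegaExpr.eval ![(m : ℝ), (n : ℝ), ε] = omega m n ε := by
  simp [omegaExpr, eval, omega]

@[simp] lemma eval_logExpr :
    logExpr.eval ![(m : ℝ), (n : ℝ), ε] = Real.log (2 * m * n) := by
  simp [logExpr, eval]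

@[simp] lemma eval_bigLExpr : bigLExpr.eval ![(m : ℝ), (n : ℝ), ε] = bigL m n ε := by
  simp [bigLExpr, eval, bigL]

@[simp] lemma eval_tauExpr : tauExpr.eval ![(m : ℝ), (n : ℝ), ε] = tau m n ε := by
  simp [tauExpr, eval, tau]

@[simp] lemma eval_iterationsExpr : iterationsExpr.eval ![(m : ℝ), (n : ℝ), ε] =
    Real.log (4 * n * Real.log (2 * m * n) / ε) / Real.log (1 / (1 - tau m n ε)) := by
  simp [iterationsExpr, eval]

/-- The next point `x`, from the registers `y = 1`, `z = 2`, `τ = 7`. -/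
def nextX : LocalExpr (Fin 12) :=
  add (mul (var 7) (var 2)) (mul (sub (const 1) (var 7)) (var 1))

/-- The next step size, from the registers `η = 4`, `τ = 7`. -/
def nextEta : LocalExpr (Fin 12) := mul (div (const 1) (sub (const 1) (var 7))) (var 4)

/-- The truncated gradient at the next point, from the accumulator `3`. -/
def nextGrad : LocalExpr (Fin 12) :=
  min (const 1) (sub (mul (var 3) (exp nextX)) (const 1))

/-- The next point `z`, with `ω` in register `6`. -/
def nextZ : LocalExpr (Fin 12) :=
  max (sub (const 0) (var 6))
    (min (const 0) (sub (var 2) (mul (mul (var 6) nextEta) nextGrad)))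

/-- The next point `y`, with `L` in register `8`. -/
def nextY : LocalExpr (Fin 12) :=
  add nextX (mul (div (const 1) (mul nextEta (var 8))) (sub nextZ (var 2)))

end LocalExpr

open LocalExpr

/-- The code run for each incident constraint: it accumulates the gradient in register `3`. -/
def absorbCode (q : Fin 12) : LocalExpr (Fin 12 ⊕ Fin 2) :=
  if q = 3 then
    add (var (Sum.inl 3)) (mul (pow (add (var (Sum.inr 1)) (const 1)) (var (Sum.inl 9)))
      (var (Sum.inr 0)))
  else var (Sum.inl q)

/-- The distributed implementation of the accelerated method. The registers hold `x`, `y`, `z`,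
the accumulated gradient, `η`, the round number, `ω`, `τ`, `L`, `1 / β`, the (unrounded) number of
iterations, and `1 + ε / n`. -/
def acceleratedProtocol : Protocol where
  numReg := 12
  start := ![sub (const 0) omegaExpr, sub (const 0) omegaExpr, sub (const 0) omegaExpr,
    const 0, div (const 1) (mul (const 3) bigLExpr), const 0, omegaExpr, tauExpr, bigLExpr,
    div (const 1) betaExpr, iterationsExpr, add (const 1) (div (var 2) (var 1))]
  play := exp nextX
  absorb := absorbCode
  finish := ![nextX, nextY, nextZ, const 0, nextEta, add (var 5) (const 1), var 6, var 7, var 8,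
    var 9, var 10, var 11]
  halt := sub (var 10) (var 5)
  result := div (exp (var 1)) (var 11)
  xReg := (0 : Fin 12)
  yReg := (1 : Fin 12)
  zReg := (2 : Fin 12)

/-! ### Correctness of the protocol. -/

variable {m n : ℕ}

/-- The contents of the registers in terms of the iterates. -/
def registers (m n : ℕ) (ε : ℝ) (k : ℕ) (x y z a : ℝ) : Fin 12 → ℝ :=
  ![x, y, z, a, eta m n ε k, k, omega m n ε, tau m n ε, bigL m n ε, 1 / beta m n ε,
    Real.log (4 * n * Real.log (2 * m * n) / ε) / Real.log (1 / (1 - tau m n ε)), 1 + ε / n]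

lemma foldl_absorbCode (ε : ℝ) (k : ℕ) (x y z a : ℝ) (c s : Fin m → ℝ) (l : List (Fin m)) :
    l.foldl (fun r i q => (absorbCode q).eval (Sum.elim r ![c i, s i]))
        (registers m n ε k x y z a) =
      registers m n ε k x y z
        (a + (l.map fun i => (s i + 1) ^ (1 / beta m n ε) * c i).sum) := by
  induction l generalizing a with
  | nil => simp
  | cons i l ih =>
    rw [List.foldl_cons, List.map_cons, List.sum_cons, ← add_assoc, ← ih]
    congr 1
    funext q
    by_cases hq : q = 3
    · subst hq
      simp [absorbCode, LocalExpr.eval, registers]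
    · have : ∀ a', registers m n ε k x y z a q = registers m n ε k x y z a' q := by
        intro a'
        fin_cases q <;> first | rfl | exact absurd rfl hq
      simp only [absorbCode, hq, if_false, LocalExpr.eval, Sum.elim_inl]
      exact this _

lemma nodup_incident (A : Matrix (Fin m) (Fin n) ℝ) (j : Fin n) : (incident A j).Nodup :=
  (List.nodup_finRange m).filter _

lemma toFinset_incident (A : Matrix (Fin m) (Fin n) ℝ) (j : Fin n) :
    (incident A j).toFinset = Finset.univ.filter fun i => A i j ≠ 0 := by
  ext i; simp [incident]

lemma sum_incident (A : Matrix (Fin m) (Fin n) ℝ) (j : Fin n) (f : Fin m → ℝ)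
    (hf : ∀ i, A i j = 0 → f i = 0) : ((incident A j).map f).sum = ∑ i, f i := by
  rw [← List.sum_toFinset f (nodup_incident A j), toFinset_incident]
  refine Finset.sum_subset (Finset.subset_univ _) fun i _ hi => hf i ?_
  simpa using hi

/-- The iterates `(x, y, z)` of the method. -/
def iterates (A : Matrix (Fin m) (Fin n) ℝ) (ε : ℝ) :
    ℕ → (Fin n → ℝ) × (Fin n → ℝ) × (Fin n → ℝ)
  | 0 => (fun _ => -omega m n ε, fun _ => -omega m n ε, fun _ => -omega m n ε)
  | k + 1 =>
    let y := (iterates A ε k).2.1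
    let z := (iterates A ε k).2.2
    let x' := tau m n ε • z + (1 - tau m n ε) • y
    let z' := fun j => boxStep (omega m n ε) (eta m n ε (k + 1))
      (min 1 (powGrad A (expo m n ε) x' j)) (z j)
    (x', x' + (1 / (eta m n ε (k + 1) * bigL m n ε)) • (z' - z), z')

variable {A : Matrix (Fin m) (Fin n) ℝ} {ε : ℝ}

/-- At the start of a round the registers contain the old `y` and `z`, which already determine the
new `x`. The agents play its exponential, so slack plus one is `(A exp x)_i`. As `p - 1 = 1/β`, the
accumulator is the gradient sum without the common factor `exp x_j`, which `nextGrad` supplies. -/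
lemma state_acceleratedProtocol (h : Admissible m n ε) (k : ℕ) :
    acceleratedProtocol.state A ε k = fun j => registers m n ε k ((iterates A ε k).1 j)
      ((iterates A ε k).2.1 j) ((iterates A ε k).2.2 j) 0 := by
  induction k with
  | zero =>
    funext j q
    change Fin 12 at q
    fin_cases q <;>
      simp [Protocol.state, acceleratedProtocol, registers, iterates, LocalExpr.eval, eta]
  | succ k ih =>
    rw [Protocol.state, ih]
    set y := (iterates A ε k).2.1 with hy
    set z := (iterates A ε k).2.2 with hz
    set x' := tau m n ε • z + (1 - tau m n ε) • y with hx'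
    funext j q
    have hslack : ∀ i, acceleratedProtocol.slack A (fun j => registers m n ε k
        ((iterates A ε k).1 j) (y j) (z j) 0) i + 1 = (A *ᵥ expVec x') i := by
      intro i
      simp only [Protocol.slack, sub_add_cancel]
      congr 2
      funext j
      simp [acceleratedProtocol, nextX, LocalExpr.eval, registers, expVec, hx']
    have hfold := foldl_absorbCode (n := n) ε k ((iterates A ε k).1 j) (y j) (z j) 0
      (fun i => A i j) (acceleratedProtocol.slack A (fun j => registers m n ε k
        ((iterates A ε k).1 j) (y j) (z j) 0)) (incident A j)
    simp only [hslack] at hfold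
    rw [sum_incident A j _ fun i hi => by rw [hi, mul_zero], zero_add] at hfold
    set a := ∑ i, (A *ᵥ expVec x') i ^ (1 / beta m n ε) * A i j with ha
    have hgrad : a * Real.exp (x' j) - 1 = powGrad A (expo m n ε) x' j := by
      rw [powGrad, h.expo_eq, add_sub_cancel_right, ha, Finset.sum_mul, neg_add_eq_sub]
      simp only [mul_assoc]
    change (acceleratedProtocol.finish q).eval (List.foldl (fun r i q => (absorbCode q).eval
      (Sum.elim r ![A i j, acceleratedProtocol.slack A (fun j => registers m n ε k
        ((iterates A ε k).1 j) (y j) (z j) 0) i])) (registers m n ε k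
        ((iterates A ε k).1 j) (y j) (z j) 0) (incident A j)) = _
    rw [hfold]
    have hX : nextX.eval (registers m n ε k ((iterates A ε k).1 j) (y j) (z j) a) = x' j := by
      simp [nextX, LocalExpr.eval, registers, hx']
    have hE : nextEta.eval (registers m n ε k ((iterates A ε k).1 j) (y j) (z j) a) =
        eta m n ε (k + 1) := by
      simp [nextEta, LocalExpr.eval, registers, eta]
    have hG : nextGrad.eval (registers m n ε k ((iterates A ε k).1 j) (y j) (z j) a) =
        min 1 (powGrad A (expo m n ε) x' j) := by
      rw [← hgrad, ← hX]
      simp [nextGrad, LocalExpr.eval, registers]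
    have hZ : nextZ.eval (registers m n ε k ((iterates A ε k).1 j) (y j) (z j) a) =
        (iterates A ε (k + 1)).2.2 j := by
      simp only [nextZ, LocalExpr.eval, hG, hE]
      simp [registers, iterates, boxStep, ← hy, ← hz, hx']
    have hY : nextY.eval (registers m n ε k ((iterates A ε k).1 j) (y j) (z j) a) =
        (iterates A ε (k + 1)).2.1 j := by
      simp only [nextY, LocalExpr.eval, hX, hE, hZ]
      simp [registers, iterates, ← hy, ← hz, hx']
    change Fin 12 at q
    fin_cases q
    · exact hX
    · exact hY
    · exact hZ
    · simp [acceleratedProtocol, LocalExpr.eval, registers]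
    · exact hE
    all_goals simp [acceleratedProtocol, LocalExpr.eval, registers]

lemma isRun_iterates (A : Matrix (Fin m) (Fin n) ℝ) (h : Admissible m n ε) :
    IsRun A ε (fun k => (iterates A ε k).1) (fun k => (iterates A ε k).2.1)
      (fun k => (iterates A ε k).2.2) where
  x_zero := rfl
  y_zero := rfl
  z_zero := rfl
  coupling _ _ := rfl
  mirror_mem _ _ := (Admissible.mem_box_iff _).2 fun _ => boxStep_mem h.omega_pos _ _ _
  mirror_min k _ := by
    intro w hw
    have h1 := sum_boxStep_quadratic_growth (η := eta m n ε (k + 1)) h.omega_pos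
      (truncGrad A ε (iterates A ε (k + 1)).1) (iterates A ε k).2.2 w
      ((Admissible.mem_box_iff _).1 hw)
    have h2 : 0 ≤ 1 / (2 * omega m n ε) * ∑ j, (w j - boxStep (omega m n ε) (eta m n ε (k + 1))
        (truncGrad A ε (iterates A ε (k + 1)).1 j) ((iterates A ε k).2.2 j)) ^ 2 := by
      have := h.omega_pos
      positivity
    have h3 : ∀ j, (iterates A ε (k + 1)).2.2 j = boxStep (omega m n ε) (eta m n ε (k + 1))
        (truncGrad A ε (iterates A ε (k + 1)).1 j) ((iterates A ε k).2.2 j) := fun j => by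
      rw [h.truncGrad_eq]; rfl
    simp only [Set.mem_ofPred_eq, h3]
    linarith
  descent _ _ := rfl

/-! ### Operation counts. -/

lemma length_incident (A : Matrix (Fin m) (Fin n) ℝ) (j : Fin n) :
    (incident A j).length = (Finset.univ.filter fun i => A i j ≠ 0).card := by
  rw [← toFinset_incident, List.toFinset_card_of_nodup (nodup_incident A j)]

lemma sum_length_incident (A : Matrix (Fin m) (Fin n) ℝ) :
    ∑ j, (incident A j).length = nonzeros A := by
  simp_rw [length_incident, nonzeros, Finset.card_filter, Fintype.sum_prod_type]
  exact Finset.sum_comm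

lemma sum_rowNonzeros (A : Matrix (Fin m) (Fin n) ℝ) : ∑ i, rowNonzeros A i = nonzeros A := by
  simp_rw [rowNonzeros, nonzeros, Finset.card_filter, Fintype.sum_prod_type]

/-- A round of any protocol takes `O(N)` operations. -/
lemma Protocol.roundCost_le (P : Protocol) (hA : Normalized A) :
    P.roundCost A ≤ (2 + P.play.cost + ∑ q, (P.absorb q).cost + ∑ q, (P.finish q).cost +
      P.halt.cost) * nonzeros A := by
  -- Every column has an entry `1`, so fixed per-agent costs can be charged to nonzero entries.
  have hn : n ≤ nonzeros A := by
    rw [← sum_length_incident]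
    calc n = ∑ _j : Fin n, 1 := by simp
      _ ≤ _ := Finset.sum_le_sum fun j _ => by
        obtain ⟨i, hi⟩ := (hA.2 j).1
        have hi : A i j = 1 := hi
        rw [length_incident]
        exact Finset.card_pos.2 ⟨i, by simp [hi]⟩
  rw [Protocol.roundCost, ← Finset.mul_sum, sum_rowNonzeros]
  simp only [Finset.sum_add_distrib, ← Finset.sum_mul, sum_length_incident, Finset.sum_const,
    Finset.card_univ, Fintype.card_fin, smul_eq_mul]
  nlinarith [Nat.mul_le_mul_right P.play.cost hn, Nat.mul_le_mul_right P.halt.cost hn,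
    Nat.mul_le_mul_right (∑ q, (P.finish q).cost) hn]

end FairPacking
end

theorem mainTheorem1 :
    ∃ (P : FairPacking.Protocol) (C : ℝ) (p : ℕ), 0 < C ∧
      ∀ (m n : ℕ) (A : Matrix (Fin m) (Fin n) ℝ) (ε : ℝ),
        FairPacking.Normalized A → 0 < ε → ε ≤ (n : ℝ) / 2 →
        -- the number of iterations is `Õ(n / ε)`, independently of the width
        (FairPacking.iterations m n ε : ℝ) ≤
            C * ((n : ℝ) / ε) * Real.log (2 + m + n + 1 / ε) ^ p ∧
        -- the distributed protocol executes the algorithm, with `O(N)` operations per iteration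
        FairPacking.IsRun A ε
            (fun k j => P.state A ε k j P.xReg)
            (fun k j => P.state A ε k j P.yReg)
            (fun k j => P.state A ε k j P.zReg) ∧
        (∀ k j, P.halt.eval (P.state A ε k j) ≤ 0 ↔ FairPacking.iterations m n ε ≤ k) ∧
        (∀ j, P.result.eval (P.state A ε (FairPacking.iterations m n ε) j) =
            FairPacking.returned ε
              (fun j' => P.state A ε (FairPacking.iterations m n ε) j' P.yReg) j) ∧
        (P.roundCost A : ℝ) ≤ C * FairPacking.nonzeros A ∧
        -- both optimization problems are solvable
        (∃ xr, FairPacking.IsRegMinimizer A ε xr) ∧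
        (∃ xs, FairPacking.IsFairSolution A xs) ∧
        -- the guarantees of the algorithm
        ∀ x y z : ℕ → Fin n → ℝ, FairPacking.IsRun A ε x y z →
          y (FairPacking.iterations m n ε) ∈ FairPacking.box m n ε ∧
          (∀ xr, FairPacking.IsRegMinimizer A ε xr →
            FairPacking.regObjective A ε (y (FairPacking.iterations m n ε)) -
              FairPacking.regObjective A ε xr ≤ ε) ∧
          FairPacking.returned ε (y (FairPacking.iterations m n ε)) ∈ FairPacking.feasible A ∧
          (∀ xs, FairPacking.IsFairSolution A xs →
            FairPacking.fairObjective xs -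
              FairPacking.fairObjective
                (FairPacking.returned ε (y (FairPacking.iterations m n ε))) ≤
              ((5 * ε : ℝ) : EReal)) := by
  refine ⟨FairPacking.acceleratedProtocol,
    6697 + ((2 + FairPacking.acceleratedProtocol.play.cost +
      ∑ q, (FairPacking.acceleratedProtocol.absorb q).cost +
      ∑ q, (FairPacking.acceleratedProtocol.finish q).cost +
      FairPacking.acceleratedProtocol.halt.cost : ℕ) : ℝ), 3, by positivity, ?_⟩
  intro m n A ε hA hε hεn
  have h := hA.admissible hε hεn
  have hstate := FairPacking.state_acceleratedProtocol (A := A) h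
  have hr := h.ratio_pos
  refine ⟨?_, ?_, ?_, ?_, ?_, ?_, hA.exists_isFairSolution h.n_pos, ?_⟩
  · refine h.iterations_le.trans ?_
    have h1 : 0 ≤ Real.log (2 + m + n + 1 / ε) := by
      have := h.one_le_m; have := h.one_le_n; have : 0 < 1 / ε := one_div_pos.2 hε
      exact Real.log_nonneg (by linarith)
    gcongr
    exact le_add_of_nonneg_right (Nat.cast_nonneg _)
  · simp only [hstate]
    exact FairPacking.isRun_iterates A h
  · intro k j
    rw [hstate]
    change (Real.log (4 * n * Real.log (2 * m * n) / ε) /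
      Real.log (1 / (1 - FairPacking.tau m n ε))) - (k : ℝ) ≤ 0 ↔ _
    -- The stored iteration count is unrounded; comparison with the integer round number performs
    -- the ceiling.
    rw [sub_nonpos]
    exact Nat.ceil_le.symm
  · intro j
    rw [hstate]
    rfl
  · have h1 : ((FairPacking.acceleratedProtocol.roundCost A : ℕ) : ℝ) ≤ _ :=
      Nat.cast_le.2 (FairPacking.acceleratedProtocol.roundCost_le hA)
    rw [Nat.cast_mul] at h1
    refine h1.trans (mul_le_mul_of_nonneg_right ?_ (Nat.cast_nonneg _))
    exact le_add_of_nonneg_left (by norm_num)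
  · exact FairPacking.exists_isRegMinimizer A h
  · intro x y z hrun
    refine ⟨hrun.y_mem_box hA h, fun xr hxr => ?_, hrun.returned_mem_feasible hA h,
      fun xs hxs => hrun.fairObjective_sub_le hA h hxs⟩
    rw [FairPacking.regObjective_eq]
    linarith [hrun.objective_le hA h hxr.1]
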